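/- Let $n\ge 0$ and regard $\mathbb{H}^{n+1}$ as a right vector space over the quaternions $\mathbb{H}$. Let $\mathrm{SL}(n+1,\mathbb{H})$ be the group of quaternionic $(n+1)\times(n+1)$ matrices $A=A_1+A_2j$ ($A_1,A_2$ complex) with $\det\begin{bmatrix}A_1&A_2\\-\overline{A_2}&\overline{A_1}\end{bmatrix}=1$, let $\mathrm{PSL}(n+1,\mathbb{H})$ be its quotient by its center $\{\pm I\}$, and let it act on the quaternionic projective space $\mathbb{P}^n_{\mathbb{H}}=(\mathbb{H}^{n+1}\setminus\{0\})/\mathbb{H}^\times$ (quotient topology) by $\gamma[v]=[Av]$, where $A$ is a lift of $\gamma$. A projective subspace of $\mathbb{P}^n_{\mathbb{H}}$ is the image of $W\setminus\{0\}$ for a nonzero $\mathbb{H}$-linear subspace $W\subseteq\mathbb{H}^{n+1}$; in particular it is non-empty. An eigenvalue of a matrix $A$ is a $\lambda\in\mathbb{H}$ with $Av=v\lambda$ for some $v\neq 0$. An element $\gamma\in\mathrm{PSL}(n+1,\mathbb{H})$ is called diagonalizable (semisimple) if a lift $A$ is, that is, if $SAS^{-1}$ is diagonal for some invertible quaternionic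 matrix $S$. The element $\gamma$, with lift $A$, is called - elliptic if it is semisimple and all eigenvalues of $A$ have modulus $1$; - parabolic if it is not semisimple and all eigenvalues of $A$ have modulus $1$; - loxodromic if it is semisimple and not all eigenvalues of $A$ have modulus $1$; - loxoparabolic if it is not semisimple and at least one eigenvalue of $A$ has modulus $\neq 1$. (None of this depends on the choice of the lift.) For a subgroup $G\subseteq\mathrm{PSL}(n+1,\mathbb{H})$ let $\mathrm{Eq}(G)$ be the set of all $z\in\mathbb{P}^n_{\mathbb{H}}$ that have an open neighborhood $U$ such that every sequence in $\{g|_U : g\in G\}$ has a subsequence that converges uniformly on the compact subsets of $U$. **Theorem.** Let $\gamma\in\mathrm{PSL}(n+1,\mathbb{H})$ and let $\Gamma=\langle\gamma\rangle$ be the cyclic subgroup generated by $\gamma$. Then: 1. $\gamma$ is elliptic if and only if $\mathrm{Eq}(\Gamma)=\mathbb{P}^n_{\mathbb{H}}$. 2. $\gamma$ is parabolic if and only if $\mathbb{P}^n_{\mathbb{H}}\setminus\mathrm{Eq}(\Gamma)$ is a single projective subspace of $\mathbb{P}^n_{\mathbb{H}}$. 3. $\gamma$ is loxodromic if and only if $\gamma$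 is diagonalizable and $\mathbb{P}^n_{\mathbb{H}}\setminus\mathrm{Eq}(\Gamma)=L_1\cup L_2$ for two proper projective subspaces $L_1,L_2$ of $\mathbb{P}^n_{\mathbb{H}}$, neither of which contains the other. 4. $\gamma$ is loxoparabolic if and only if $\gamma$ is not diagonalizable and $\mathbb{P}^n_{\mathbb{H}}\setminus\mathrm{Eq}(\Gamma)=L_1\cup L_2$ for two proper projective subspaces $L_1,L_2$ of $\mathbb{P}^n_{\mathbb{H}}$, neither of which contains the other. -/

import Mathlib

open scoped Quaternion Matrix LinearAlgebra.Projectivization Topology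

noncomputable section

/-! ### Quaternionic matrices, the quaternionic determinant, `SL(n+1, ℍ)` and `PSL(n+1, ℍ)` -/

/-- Square quaternionic matrices of size `n + 1`. -/
abbrev MatH (n : ℕ) : Type := Matrix (Fin (n + 1)) (Fin (n + 1)) ℍ[ℝ]

/-- `ℍ^{n+1}`, regarded as a right `ℍ`-vector space, that is, as a module over `ℍᵐᵒᵖ`. -/
abbrev VecH (n : ℕ) : Type := Fin (n + 1) → ℍ[ℝ]

/-- Writing `q = a + b j` with `a b : ℂ`, this is `a`. -/
def quatFst (q : ℍ[ℝ]) : ℂ := ⟨q.re, q.imI⟩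

/-- Writing `q = a + b j` with `a b : ℂ`, this is `b`. -/
def quatSnd (q : ℍ[ℝ]) : ℂ := ⟨q.imJ, q.imK⟩

/-- The standard embedding `A₁ + A₂ j ↦ [A₁, A₂; -conj A₂, conj A₁]` of quaternionic matrices
into complex matrices of twice the size. -/
def complexEmbed {n : ℕ} (A : MatH n) :
    Matrix (Fin (n + 1) ⊕ Fin (n + 1)) (Fin (n + 1) ⊕ Fin (n + 1)) ℂ :=
  Matrix.fromBlocks (A.map quatFst) (A.map quatSnd)
    (-(A.map fun q => star (quatSnd q))) (A.map fun q => star (quatFst q))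

theorem quatFst_mul (p q : ℍ[ℝ]) :
    quatFst (p * q) = quatFst p * quatFst q - quatSnd p * star (quatSnd q) := by
  apply Complex.ext <;> simp [quatFst, quatSnd] <;> ring

theorem quatSnd_mul (p q : ℍ[ℝ]) :
    quatSnd (p * q) = quatFst p * quatSnd q + quatSnd p * star (quatFst q) := by
  apply Complex.ext <;> simp [quatFst, quatSnd] <;> ring

theorem quatFst_sum {ι : Type*} (s : Finset ι) (f : ι → ℍ[ℝ]) :
    quatFst (∑ i ∈ s, f i) = ∑ i ∈ s, quatFst (f i) :=
  map_sum (⟨⟨quatFst, by apply Complex.ext <;> simp [quatFst]⟩,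
    fun a b => by apply Complex.ext <;> simp [quatFst]⟩ : ℍ[ℝ] →+ ℂ) f s

theorem quatSnd_sum {ι : Type*} (s : Finset ι) (f : ι → ℍ[ℝ]) :
    quatSnd (∑ i ∈ s, f i) = ∑ i ∈ s, quatSnd (f i) :=
  map_sum (⟨⟨quatSnd, by apply Complex.ext <;> simp [quatSnd]⟩,
    fun a b => by apply Complex.ext <;> simp [quatSnd]⟩ : ℍ[ℝ] →+ ℂ) f s

theorem complexEmbed_mul {n : ℕ} (A B : MatH n) :
    complexEmbed (A * B) = complexEmbed A * complexEmbed B := by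
  ext (i | i) (j | j) <;>
    simp [complexEmbed, Matrix.mul_apply, quatFst_sum, quatSnd_sum, quatFst_mul, quatSnd_mul,
      Finset.sum_add_distrib, Finset.sum_sub_distrib] <;> ring

theorem complexEmbed_one {n : ℕ} : complexEmbed (1 : MatH n) = 1 := by
  have h0 : quatFst 0 = 0 := rfl
  have h1 : quatSnd 0 = 0 := rfl
  have h2 : quatFst 1 = 1 := rfl
  have h3 : quatSnd 1 = 0 := rfl
  ext (i | i) (j | j) <;> by_cases h : i = j <;>
    simp [complexEmbed, Matrix.one_apply, h, h0, h1, h2, h3]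

/-- The quaternionic determinant `det_ℍ A = det (Φ A)`. -/
def detH {n : ℕ} (A : MatH n) : ℂ := (complexEmbed A).det

/-- `det_ℍ` as a multiplicative map. -/
def detHHom (n : ℕ) : MatH n →* ℂ where
  toFun := detH
  map_one' := by simp [detH, complexEmbed_one]
  map_mul' A B := by simp [detH, complexEmbed_mul]

/-- `SL(n+1, ℍ)`: the invertible quaternionic matrices `A` with `det_ℍ A = 1`. -/
def SLH (n : ℕ) : Subgroup (MatH n)ˣ where
  carrier := {A | detH (A : MatH n) = 1}
  one_mem' := (detHHom n).map_one
  mul_mem' {A B} hA hB := by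
    have h := (detHHom n).map_mul (A : MatH n) (B : MatH n)
    have hA' : detHHom n (A : MatH n) = 1 := hA
    have hB' : detHHom n (B : MatH n) = 1 := hB
    rw [hA', hB', one_mul] at h
    exact h
  inv_mem' {A} hA := by
    have h := (detHHom n).map_mul (A : MatH n) ((A⁻¹ : (MatH n)ˣ) : MatH n)
    have hA' : detHHom n (A : MatH n) = 1 := hA
    rw [Units.mul_inv, map_one, hA', one_mul] at h
    exact h.symm

/-- `PSL(n+1, ℍ)`: the quotient of `SL(n+1, ℍ)` by its center. -/
abbrev PSLH (n : ℕ) : Type := ↥(SLH n) ⧸ Subgroup.center ↥(SLH n)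

/-! ### Quaternionic projective space -/

/-- `ℙ^n_ℍ`: nonzero vectors of `ℍ^{n+1}` up to right multiplication by nonzero quaternions. -/
abbrev HProj (n : ℕ) : Type := ℙ ℍ[ℝ]ᵐᵒᵖ (VecH n)

/-- The quotient topology on `ℙ^n_ℍ`. -/
instance HProj.instTopologicalSpace (n : ℕ) : TopologicalSpace (HProj n) :=
  TopologicalSpace.coinduced (Projectivization.mk' ℍ[ℝ]ᵐᵒᵖ : {v : VecH n // v ≠ 0} → HProj n)
    inferInstance

theorem HProj.continuous_mk' (n : ℕ) :
    Continuous (Projectivization.mk' ℍ[ℝ]ᵐᵒᵖ : {v : VecH n // v ≠ 0} → HProj n) :=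
  continuous_coinduced_rng

instance HProj.instCompactSpace (n : ℕ) : CompactSpace (HProj n) := by
  have : ProperSpace ℍ[ℝ] := FiniteDimensional.proper_real ℍ[ℝ]
  have hS : CompactSpace (Metric.sphere (0 : VecH n) 1) :=
    isCompact_iff_compactSpace.mp (isCompact_sphere _ _)
  let f : Metric.sphere (0 : VecH n) 1 → HProj n := fun v =>
    Projectivization.mk' ℍ[ℝ]ᵐᵒᵖ ⟨v.1, fun h => by
      have h1 := mem_sphere_zero_iff_norm.mp v.2
      rw [h, norm_zero] at h1
      exact zero_ne_one h1⟩
  have hf : Continuous f :=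
    (HProj.continuous_mk' n).comp (Continuous.subtype_mk continuous_subtype_val _)
  suffices hs : Function.Surjective f from hs.compactSpace hf
  intro p
  induction p using Projectivization.ind with
  | h v hv =>
    have hn : ‖v‖ ≠ 0 := norm_ne_zero_iff.mpr hv
    refine ⟨⟨‖v‖⁻¹ • v, by simp [norm_smul, hn]⟩, ?_⟩
    refine (Projectivization.mk_eq_mk_iff' _ _ _ _ _).mpr
      ⟨MulOpposite.op (((‖v‖⁻¹ : ℝ) : ℍ[ℝ])), ?_⟩
    funext i
    simp only [Pi.smul_apply, MulOpposite.smul_eq_mul_unop, MulOpposite.unop_op]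
    rw [Quaternion.mul_coe_eq_smul]

theorem HProj.sum_normSq_ne_zero {n : ℕ} {v : VecH n} (hv : v ≠ 0) :
    ∑ i, Quaternion.normSq (v i) ≠ 0 := by
  intro h
  apply hv
  rw [Finset.sum_eq_zero_iff_of_nonneg fun i _ => Quaternion.normSq_nonneg] at h
  funext i
  exact Quaternion.normSq_eq_zero.mp (h i (Finset.mem_univ i))

/-- The orthogonal projection onto a quaternionic line, as a matrix; used only to see that `ℙ^n_ℍ`
is Hausdorff. -/
def HProj.toMat {n : ℕ} : HProj n → MatH n :=
  Projectivization.lift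
    (fun v => Matrix.of fun i j =>
      (∑ k, Quaternion.normSq (v.1 k))⁻¹ • (v.1 i * star (v.1 j))) (by
    rintro ⟨a, ha⟩ ⟨b, hb⟩ t h
    simp only at h
    subst h
    ext1 i j
    have ht : Quaternion.normSq (MulOpposite.unop t) ≠ 0 := by
      intro h0
      apply ha
      have : t = 0 := MulOpposite.unop_injective (Quaternion.normSq_eq_zero.mp h0)
      rw [this, zero_smul]
    have key : ∀ x y : ℍ[ℝ], x * MulOpposite.unop t * star (y * MulOpposite.unop t) =
        Quaternion.normSq (MulOpposite.unop t) • (x * star y) := by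
      intro x y
      rw [star_mul, mul_assoc, ← mul_assoc (MulOpposite.unop t), Quaternion.self_mul_star,
        Quaternion.coe_mul_eq_smul, mul_smul_comm]
    simp only [Matrix.of_apply, Pi.smul_apply, MulOpposite.smul_eq_mul_unop, map_mul, key]
    rw [← Finset.sum_mul, smul_smul, mul_inv, mul_assoc, inv_mul_cancel₀ ht, mul_one])

theorem HProj.continuous_toMat (n : ℕ) : Continuous (HProj.toMat : HProj n → MatH n) := by
  refine continuous_coinduced_dom.mpr ?_
  refine continuous_matrix fun i j => ?_
  have hc : ∀ k, Continuous fun v : {v : VecH n // v ≠ 0} => v.1 k := fun k =>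
    (continuous_apply k).comp continuous_subtype_val
  have h1 : Continuous fun v : {v : VecH n // v ≠ 0} => ∑ k, Quaternion.normSq (v.1 k) :=
    continuous_finsetSum _ fun k _ => Quaternion.continuous_normSq.comp (hc k)
  exact (h1.inv₀ fun v => HProj.sum_normSq_ne_zero v.2).smul ((hc i).mul ((hc j).star))

theorem HProj.toMat_injective (n : ℕ) : Function.Injective (HProj.toMat : HProj n → MatH n) := by
  intro p q h
  induction p using Projectivization.ind with
  | h v hv =>
  induction q using Projectivization.ind with
  | h w hw =>
  have hS := HProj.sum_normSq_ne_zero hv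
  refine (Projectivization.mk_eq_mk_iff' _ _ _ _ _).mpr
    ⟨MulOpposite.op ((∑ k, Quaternion.normSq (w k))⁻¹ • ∑ j, star (w j) * v j), ?_⟩
  funext i
  have hij : ∀ j, (∑ k, Quaternion.normSq (v k))⁻¹ • (v i * star (v j)) =
      (∑ k, Quaternion.normSq (w k))⁻¹ • (w i * star (w j)) := fun j =>
    congrFun (congrFun h i) j
  have h1 : ∑ j, ((∑ k, Quaternion.normSq (v k))⁻¹ • (v i * star (v j))) * v j = v i := by
    simp only [smul_mul_assoc, mul_assoc, Quaternion.star_mul_self, Quaternion.mul_coe_eq_smul]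
    rw [← Finset.smul_sum, ← Finset.sum_smul, smul_smul, inv_mul_cancel₀ hS, one_smul]
  rw [← h1]
  simp only [hij, Pi.smul_apply, MulOpposite.smul_eq_mul_unop, MulOpposite.unop_op,
    mul_smul_comm, smul_mul_assoc, Finset.mul_sum, Finset.smul_sum, mul_assoc]

instance HProj.instT2Space (n : ℕ) : T2Space (HProj n) :=
  T2Space.of_injective_continuous (HProj.toMat_injective n) (HProj.continuous_toMat n)

/-- The unique uniform structure on the compact Hausdorff space `ℙ^n_ℍ`: the entourages are
the neighborhoods of the diagonal. -/
instance HProj.instUniformSpace (n : ℕ) : UniformSpace (HProj n) :=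
  { (uniformSpaceOfCompactR1 : UniformSpace (HProj n)) with
    toTopologicalSpace := HProj.instTopologicalSpace n }

/-- A projective subspace of `ℙ^n_ℍ`: the image of the nonzero vectors of a nonzero right
`ℍ`-linear subspace of `ℍ^{n+1}`. -/
def IsProjSubspace {n : ℕ} (L : Set (HProj n)) : Prop :=
  ∃ W : Submodule ℍ[ℝ]ᵐᵒᵖ (VecH n), W ≠ ⊥ ∧
    L = {p | ∃ (v : VecH n) (hv : v ≠ 0), v ∈ W ∧ p = Projectivization.mk ℍ[ℝ]ᵐᵒᵖ v hv}

/-! ### The action of `PSL(n+1, ℍ)` on `ℙ^n_ℍ` -/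

/-- A quaternionic matrix acts on `ℍ^{n+1}` from the left, as a right-linear map. -/
def matHToEnd (n : ℕ) : MatH n →* Module.End ℍ[ℝ]ᵐᵒᵖ (VecH n) where
  toFun A :=
    { toFun := fun v => A *ᵥ v
      map_add' := fun v w => Matrix.mulVec_add A v w
      map_smul' := fun c v => Matrix.mulVec_smul A c v }
  map_one' := LinearMap.ext fun v => Matrix.one_mulVec v
  map_mul' A B := LinearMap.ext fun v => (Matrix.mulVec_mulVec v A B).symm

/-- The action of `SL(n+1, ℍ)` on `ℙ^n_ℍ`, `A [v] = [A v]`. -/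
def slhAction (n : ℕ) : ↥(SLH n) →* Equiv.Perm (HProj n) :=
  ((MulAction.toPermHom (Module.End ℍ[ℝ]ᵐᵒᵖ (VecH n))ˣ (HProj n)).comp
    (Units.map (matHToEnd n))).comp (SLH n).subtype

theorem SLH.commutator_mem {n : ℕ} (A B : (MatH n)ˣ) : A * B * A⁻¹ * B⁻¹ ∈ SLH n := by
  have h : Units.map (detHHom n) (A * B * A⁻¹ * B⁻¹) = 1 := by
    simp only [map_mul, map_inv]
    rw [mul_comm (Units.map (detHHom n) A), mul_inv_cancel_right, mul_inv_cancel]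
  exact congrArg Units.val h

theorem SLH.scalar_commutator_comm {n : ℕ} {M : MatH n} {q : ℍ[ℝ]}
    (hM : ∀ B ∈ SLH n, (B : MatH n) * M = M * B) (hq : Matrix.scalar (Fin (n + 1)) q = M)
    (a b : ℍ[ℝ]ˣ) : ((a * b * a⁻¹ * b⁻¹ : ℍ[ℝ]ˣ) : ℍ[ℝ]) * q =
      q * ((a * b * a⁻¹ * b⁻¹ : ℍ[ℝ]ˣ) : ℍ[ℝ]) := by
  let s : ℍ[ℝ]ˣ →* (MatH n)ˣ := Units.map (Matrix.scalar (Fin (n + 1))).toMonoidHom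
  have h := hM _ (SLH.commutator_mem (s a) (s b))
  rw [← map_inv, ← map_inv, ← map_mul, ← map_mul, ← map_mul, ← hq] at h
  have h' : Matrix.scalar (Fin (n + 1)) (((a * b * a⁻¹ * b⁻¹ : ℍ[ℝ]ˣ) : ℍ[ℝ]) * q) =
      Matrix.scalar (Fin (n + 1)) (q * ((a * b * a⁻¹ * b⁻¹ : ℍ[ℝ]ˣ) : ℍ[ℝ])) := by
    rw [map_mul, map_mul]
    exact h
  have h0 := congrFun (congrFun h' 0) 0
  simpa using h0

/-- The elements of the center of `SL(n+1, ℍ)` are real scalar matrices. -/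
theorem SLH.center_scalar {n : ℕ} {A : ↥(SLH n)} (hA : A ∈ Subgroup.center ↥(SLH n)) :
    ∃ q : ℍ[ℝ], Matrix.scalar (Fin (n + 1)) q = ((A : (MatH n)ˣ) : MatH n) ∧
      ∀ x, q * x = x * q := by
  have hM : ∀ B ∈ SLH n, (B : MatH n) * ((A : (MatH n)ˣ) : MatH n) =
      ((A : (MatH n)ˣ) : MatH n) * B := fun B hB =>
    congrArg (fun C : ↥(SLH n) => ((C : (MatH n)ˣ) : MatH n))
      (Subgroup.mem_center_iff.mp hA ⟨B, hB⟩)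
  obtain ⟨q, hq⟩ := Matrix.mem_range_scalar_of_commute_single
    (M := ((A : (MatH n)ˣ) : MatH n)) (by
      intro i j hij
      have hz : Matrix.single i j (1 : ℍ[ℝ]) * Matrix.single i j (1 : ℍ[ℝ]) = 0 :=
        Matrix.single_mul_single_of_ne _ _ _ _ hij.symm _
      let T : (MatH n)ˣ := ⟨1 + Matrix.single i j 1, 1 - Matrix.single i j 1,
        by noncomm_ring; simp [hz], by noncomm_ring; simp [hz]⟩
      have hT : T ∈ SLH n := by
        have h0 : quatFst 0 = 0 := rfl
        have h1 : quatSnd 0 = 0 := rfl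
        have h2 : quatFst 1 = 1 := rfl
        have h3 : quatSnd 1 = 0 := rfl
        have hs : complexEmbed (1 + Matrix.single i j 1 : MatH n) =
            Matrix.fromBlocks (Matrix.transvection i j 1) 0 0 (Matrix.transvection i j 1) := by
          have e1 : ∀ k l, (1 + Matrix.single i j 1 : MatH n) k l =
              (((if k = l then 1 else 0) + if i = k ∧ j = l then 1 else 0 : ℝ) : ℍ[ℝ]) := by
            intro k l
            simp only [Matrix.add_apply, Matrix.one_apply, Matrix.single_apply]
            split_ifs <;> simp
          ext (k | k) (l | l) <;>
            simp only [complexEmbed, Matrix.fromBlocks_apply₁₁, Matrix.fromBlocks_apply₁₂,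
              Matrix.fromBlocks_apply₂₁, Matrix.fromBlocks_apply₂₂, Matrix.map_apply, e1,
              Matrix.neg_apply, Matrix.transvection, Matrix.add_apply, Matrix.one_apply,
              Matrix.single_apply, Matrix.zero_apply] <;>
            split_ifs <;> apply Complex.ext <;> simp [quatFst, quatSnd]
        change (complexEmbed (1 + Matrix.single i j 1 : MatH n)).det = 1
        rw [hs, Matrix.det_fromBlocks_zero₂₁, Matrix.det_transvection_of_ne i j hij, one_mul]
      have h := hM T hT
      change (1 + Matrix.single i j 1) * _ = _ * (1 + Matrix.single i j 1) at h
      rw [add_mul, mul_add, one_mul, mul_one] at h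
      exact add_left_cancel h)
  refine ⟨q, hq, ?_⟩
  obtain ⟨qi, i0, i1, i2, i3⟩ : ∃ p : ℍ[ℝ], p.re = 0 ∧ p.imI = 1 ∧ p.imJ = 0 ∧ p.imK = 0 :=
    ⟨⟨0, 1, 0, 0⟩, rfl, rfl, rfl, rfl⟩
  obtain ⟨qj, j0, j1, j2, j3⟩ : ∃ p : ℍ[ℝ], p.re = 0 ∧ p.imI = 0 ∧ p.imJ = 1 ∧ p.imK = 0 :=
    ⟨⟨0, 0, 1, 0⟩, rfl, rfl, rfl, rfl⟩
  have hi0 : qi ≠ 0 := fun h => by simp [h] at i1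
  have hj0 : qj ≠ 0 := fun h => by simp [h] at j2
  have hi1 : 1 + qi ≠ 0 := fun h => by
    have := congrArg QuaternionAlgebra.re h
    simp [i0] at this
  have hj1 : 1 + qj ≠ 0 := fun h => by
    have := congrArg QuaternionAlgebra.re h
    simp [j0] at this
  have e1 : qi * (1 + qj) * qi⁻¹ * (1 + qj)⁻¹ = -qj := by
    rw [mul_inv_eq_iff_eq_mul₀ hj1, mul_inv_eq_iff_eq_mul₀ hi0]
    ext <;> simp [i0, i1, i2, i3, j0, j1, j2, j3]
  have e2 : qj * (1 + qi) * qj⁻¹ * (1 + qi)⁻¹ = -qi := by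
    rw [mul_inv_eq_iff_eq_mul₀ hi1, mul_inv_eq_iff_eq_mul₀ hj0]
    ext <;> simp [i0, i1, i2, i3, j0, j1, j2, j3]
  have c1 := SLH.scalar_commutator_comm hM hq (Units.mk0 qi hi0) (Units.mk0 (1 + qj) hj1)
  have c2 := SLH.scalar_commutator_comm hM hq (Units.mk0 qj hj0) (Units.mk0 (1 + qi) hi1)
  simp only [Units.val_mul, Units.val_inv_eq_inv_val, Units.val_mk0] at c1 c2
  rw [e1] at c1
  rw [e2] at c2
  have a1 := congrArg QuaternionAlgebra.imI c1
  have a2 := congrArg QuaternionAlgebra.imK c1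
  have a3 := congrArg QuaternionAlgebra.imK c2
  simp [i0, i1, i2, i3, j0, j1, j2, j3] at a1 a2 a3
  have r1 : q.imI = 0 := by linarith
  have r2 : q.imJ = 0 := by linarith
  have r3 : q.imK = 0 := by linarith
  intro x
  ext <;> simp [r1, r2, r3] <;> ring

/-- The induced action of `PSL(n+1, ℍ)` on `ℙ^n_ℍ`. -/
def pslhAction (n : ℕ) : PSLH n →* Equiv.Perm (HProj n) :=
  QuotientGroup.lift (Subgroup.center ↥(SLH n)) (slhAction n) (by
    intro A hA
    obtain ⟨q, hq, hc⟩ := SLH.center_scalar hA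
    ext p
    induction p using Projectivization.ind with
    | h v hv =>
      refine (Projectivization.mk_eq_mk_iff' _ _ _ _ _).mpr ⟨MulOpposite.op q, ?_⟩
      change MulOpposite.op q • v = ((A : (MatH n)ˣ) : MatH n) *ᵥ v
      rw [← hq]
      funext i
      simp [Matrix.scalar_apply, Matrix.mulVec_diagonal, hc])

/-! ### Dynamical types -/

/-- `q` is a right eigenvalue of `A`: there is a nonzero vector `v` with `A v = v q`. -/
def IsRightEigenvalue {n : ℕ} (A : MatH n) (q : ℍ[ℝ]) : Prop :=
  ∃ v : VecH n, v ≠ 0 ∧ A *ᵥ v = fun i => v i * q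

/-- `A` is diagonalizable (equivalently, semisimple) over `ℍ`. -/
def IsDiagonalizableH {n : ℕ} (A : MatH n) : Prop :=
  ∃ (S : (MatH n)ˣ) (d : Fin (n + 1) → ℍ[ℝ]),
    (S : MatH n) * A * ((S⁻¹ : (MatH n)ˣ) : MatH n) = Matrix.diagonal d

/-- `A ∈ SL(n+1, ℍ)` is a lift of `γ ∈ PSL(n+1, ℍ)`. Every `γ` has exactly two lifts, `A` and `-A`;
the properties below do not depend on which one is used. -/
def IsLift {n : ℕ} (A : ↥(SLH n)) (γ : PSLH n) : Prop := (QuotientGroup.mk A : PSLH n) = γ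

namespace PSLH

variable {n : ℕ}

/-- `γ` is diagonalizable (semisimple). -/
def IsDiagonalizable (γ : PSLH n) : Prop :=
  ∃ A : ↥(SLH n), IsLift A γ ∧ IsDiagonalizableH ((A : (MatH n)ˣ) : MatH n)

/-- All eigenvalues of `γ` have unit modulus. Similar quaternions have the same modulus, so that
this may be tested on all right eigenvalues. -/
def HasUnitEigenvalues (γ : PSLH n) : Prop :=
  ∃ A : ↥(SLH n), IsLift A γ ∧
    ∀ q, IsRightEigenvalue ((A : (MatH n)ˣ) : MatH n) q → ‖q‖ = 1

/-- Elliptic: semisimple, all eigenvalues of unit modulus. -/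
def IsElliptic (γ : PSLH n) : Prop := γ.IsDiagonalizable ∧ γ.HasUnitEigenvalues

/-- Parabolic: not semisimple, all eigenvalues of unit modulus. -/
def IsParabolic (γ : PSLH n) : Prop := ¬ γ.IsDiagonalizable ∧ γ.HasUnitEigenvalues

/-- Loxodromic: semisimple, not all eigenvalues of unit modulus. -/
def IsLoxodromic (γ : PSLH n) : Prop := γ.IsDiagonalizable ∧ ¬ γ.HasUnitEigenvalues

/-- Loxoparabolic: not semisimple, some eigenvalue of non-unit modulus. -/
def IsLoxoparabolic (γ : PSLH n) : Prop := ¬ γ.IsDiagonalizable ∧ ¬ γ.HasUnitEigenvalues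

end PSLH

/-! ### Normal families and the region of equicontinuity -/

/-- A family of maps from a topological space to `ℙ^n_ℍ` is normal if every sequence in it has a
subsequence that converges uniformly on compact subsets. -/
def IsNormalFamily {X : Type*} [TopologicalSpace X] {n : ℕ} (F : Set (X → HProj n)) : Prop :=
  ∀ f : ℕ → X → HProj n, (∀ m, f m ∈ F) →
    ∃ φ : ℕ → ℕ, StrictMono φ ∧ ∃ g : X → HProj n,
      ∀ K : Set X, IsCompact K → TendstoUniformlyOn (fun m => f (φ m)) g Filter.atTop K

/-- The region of equicontinuity of a subgroup `G` of `PSL(n+1, ℍ)`: the points with an open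
neighborhood `U` such that the family of the restrictions `g|_U`, `g ∈ G`, is normal. -/
def eqRegion {n : ℕ} (G : Subgroup (PSLH n)) : Set (HProj n) :=
  {z | ∃ U : Set (HProj n), IsOpen U ∧ z ∈ U ∧
    IsNormalFamily {f : U → HProj n | ∃ g ∈ G, f = fun x : U => pslhAction n g x}}

/-- `Z` is the union of two proper projective subspaces that are genuinely two: neither of them
contains the other. -/
def IsUnionOfTwoProperSubspaces {n : ℕ} (Z : Set (HProj n)) : Prop :=
  ∃ L₁ L₂ : Set (HProj n), IsProjSubspace L₁ ∧ IsProjSubspace L₂ ∧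
    L₁ ≠ Set.univ ∧ L₂ ≠ Set.univ ∧ ¬ L₁ ⊆ L₂ ∧ ¬ L₂ ⊆ L₁ ∧ Z = L₁ ∪ L₂

end

/-! Right multiplication by `ℂ ⊆ ℍ` makes `ℍ^{n+1}` a complex vector space on which a lift `A` acts
as a complex endomorphism `T`. Let `R` be the spectral radius of `T` and `k + 1` the largest size of
a Jordan block whose eigenvalue has modulus `R`. The powers `T ^ m`, divided by `R ^ m * (m + 1) ^
k`, stay bounded and do not tend to zero. Their limit points `M` may differ, but all have the same
kernel, the space `K(T)` of vectors whose rescaled orbit tends to `0` (`growthSmall`). The reason is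
that every rescaled orbit is asymptotic to a finite sum of independent eigenvectors with unimodular
coefficients, and such a sum cannot be small along a subsequence unless it vanishes.

Rescaling does not change projective maps. So away from `K(T)` the positive powers subconverge
locally uniformly to `[v] ↦ [M v]`, while at a point of `K(T)` different approaches to that point
have different limits. Negative powers are treated in the same way with `T⁻¹`. Hence the complement
of the region of equicontinuity is `ℙ(K(T)) ∪ ℙ(K(T⁻¹))` (`compl_eqRegion_zpowers`).

It remains to compare the two subspaces. If `A` is diagonalizable with unimodular eigenvalues, all
powers are uniformly bounded and both subspaces vanish. If the eigenvalues are unimodular and `A` is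
not diagonalizable, then `k ≥ 1`, and the subspaces coincide and are nonzero. Otherwise `det = 1`
forces two different eigenvalue moduli; a dominant vector of `T⁻¹` lies in `K(T)` but not in
`K(T⁻¹)`, and symmetrically, so neither subspace contains the other. The three resulting shapes
exclude each other, which gives the converse implications. -/

/-! ### Growth of the powers of an endomorphism of a complex vector space -/

/-- The reciprocal of `R ^ m * (m + 1) ^ k`, the order of growth of the powers of a Jordan block of
size `k + 1` whose eigenvalue has modulus `R`. -/
noncomputable def growthScale (R : ℝ) (k m : ℕ) : ℝ := (R ^ m * ((m : ℝ) + 1) ^ k)⁻¹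

theorem growthScale_pos {R : ℝ} (hR : 0 < R) (k m : ℕ) : 0 < growthScale R k m := by
  unfold growthScale; positivity

/-- This limit and the next two decide which terms of the binomial expansion of `T ^ m` survive
rescaling: only index `k` at an eigenvalue of modulus `R`. Here a geometric decay beats a
polynomial. -/
theorem tendsto_growthScale_mul_of_lt {R a : ℝ} (ha : 0 ≤ a) (haR : a < R) (k i : ℕ) :
    Filter.Tendsto (fun m : ℕ => growthScale R k m * (m.choose i * a ^ m)) Filter.atTop (𝓝 0) := by
  have hR : 0 < R := ha.trans_lt haR
  have h := tendsto_pow_const_mul_const_pow_of_abs_lt_one i (r := a / R)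
    (by rw [abs_of_nonneg (by positivity), div_lt_one hR]; exact haR)
  refine squeeze_zero (fun m => by have := growthScale_pos hR k m; positivity) (fun m => ?_) h
  have h1 : (m.choose i : ℝ) ≤ (m : ℝ) ^ i := by exact_mod_cast Nat.choose_le_pow m i
  have h2 : (1 : ℝ) ≤ ((m : ℝ) + 1) ^ k := one_le_pow₀ (by linarith [m.cast_nonneg (α := ℝ)])
  have e : growthScale R k m * (m.choose i * a ^ m) =
      (((m : ℝ) + 1) ^ k)⁻¹ * (m.choose i * (a / R) ^ m) := by
    rw [growthScale, div_pow]; field_simp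
  rw [e]
  calc _ ≤ 1 * ((m.choose i : ℝ) * (a / R) ^ m) := by
        gcongr; exact inv_le_one_of_one_le₀ h2
    _ ≤ _ := by rw [one_mul]; gcongr

theorem tendsto_growthScale_mul_of_index_lt {R : ℝ} (hR : 0 < R) {k i : ℕ} (hik : i < k) :
    Filter.Tendsto (fun m : ℕ => growthScale R k m * (m.choose i * R ^ m)) Filter.atTop (𝓝 0) := by
  refine squeeze_zero (fun m => by have := growthScale_pos hR k m; positivity) (fun m => ?_)
    (tendsto_one_div_add_atTop_nhds_zero_nat (𝕜 := ℝ))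
  have h1 : (m.choose i : ℝ) ≤ (m : ℝ) ^ i := by exact_mod_cast Nat.choose_le_pow m i
  have h2 : (m : ℝ) ^ i ≤ ((m : ℝ) + 1) ^ i := by gcongr; linarith
  have h3 : ((m : ℝ) + 1) ^ (i + 1) ≤ ((m : ℝ) + 1) ^ k :=
    pow_le_pow_right₀ (by linarith [m.cast_nonneg (α := ℝ)]) hik
  have e : growthScale R k m * (m.choose i * R ^ m) = (m.choose i : ℝ) / ((m : ℝ) + 1) ^ k := by
    rw [growthScale]; field_simp
  rw [e, div_le_div_iff₀ (by positivity) (by positivity), one_mul]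
  calc (m.choose i : ℝ) * ((m : ℝ) + 1) ≤ ((m : ℝ) + 1) ^ i * ((m : ℝ) + 1) := by
        gcongr; exact h1.trans h2
    _ ≤ _ := by rw [← pow_succ]; exact h3

theorem tendsto_growthScale_mul_self {R : ℝ} (hR : 0 < R) (k : ℕ) :
    Filter.Tendsto (fun m : ℕ => growthScale R k m * (m.choose k * R ^ m)) Filter.atTop
      (𝓝 ((k.factorial : ℝ)⁻¹)) := by
  have h1 : Filter.Tendsto (fun m : ℕ => (m.choose k : ℝ) / ((m : ℝ) ^ k / k.factorial))
      Filter.atTop (𝓝 1) := by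
    refine (Asymptotics.isEquivalent_iff_tendsto_one ?_).mp (isEquivalent_choose k)
    filter_upwards [Filter.eventually_gt_atTop 0] with m hm
    positivity
  have h2 : Filter.Tendsto (fun m : ℕ => ((m : ℝ) / ((m : ℝ) + 1)) ^ k) Filter.atTop (𝓝 1) := by
    simpa using (tendsto_natCast_div_add_atTop (𝕜 := ℝ) 1).pow k
  have h3 := (h1.mul h2).mul_const ((k.factorial : ℝ)⁻¹)
  rw [one_mul, one_mul] at h3
  refine h3.congr' ?_
  filter_upwards [Filter.eventually_gt_atTop 0] with m hm
  have hm' : (0 : ℝ) < m := by exact_mod_cast hm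
  have := k.factorial_pos
  rw [growthScale, div_pow]
  field_simp

section

variable {V : Type*} [NormedAddCommGroup V] [NormedSpace ℂ V]

/-- Binomial theorem for `T = N + μ`. Writing `μ ^ (m - i)` as `μ ^ m * μ⁻¹ ^ i` makes the range of
summation independent of `m`, so that limits can be taken term by term. -/
theorem pow_apply_eq_sum_of_pow_sub_apply_eq_zero {T : Module.End ℂ V} {μ : ℂ} (hμ : μ ≠ 0) {K : ℕ}
    {v : V} (hv : ((T - μ • 1) ^ K) v = 0) (m : ℕ) :
    (T ^ m) v = ∑ i ∈ Finset.range K, ((m.choose i : ℂ) * μ ^ m) • ((μ⁻¹) ^ i • ((T - μ • 1) ^ i) v) := by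
  set N := T - μ • 1 with hN
  have hT : T = N + μ • 1 := by rw [hN]; abel
  have hc : Commute N (μ • (1 : Module.End ℂ V)) := (Commute.one_right N).smul_right μ
  have hz : ∀ i, K ≤ i → (N ^ i) v = 0 := by
    intro i hi
    rw [← Nat.sub_add_cancel hi, pow_add, Module.End.mul_apply, hv, map_zero]
  have h1 : (T ^ m) v = ∑ i ∈ Finset.range (m + 1),
      ((m.choose i : ℂ) * μ ^ m) • ((μ⁻¹) ^ i • (N ^ i) v) := by
    rw [hT, hc.add_pow, LinearMap.sum_apply]
    refine Finset.sum_congr rfl fun i hi => ?_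
    have hi' : i ≤ m := Nat.lt_succ_iff.mp (Finset.mem_range.mp hi)
    have : μ ^ (m - i) = μ ^ m * (μ⁻¹) ^ i := by
      rw [pow_sub₀ μ hμ hi', inv_pow]
    rw [smul_pow, one_pow, mul_smul_comm, mul_one, ← nsmul_eq_mul', LinearMap.smul_apply,
      LinearMap.smul_apply, ← Nat.cast_smul_eq_nsmul ℂ, smul_smul, smul_smul, this, mul_assoc]
  rw [h1]
  rcases le_total (m + 1) K with h | h
  · refine Finset.sum_subset (Finset.range_mono h) fun i _ hi => ?_
    rw [Nat.choose_eq_zero_of_lt (by simpa using hi)]; simp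
  · refine (Finset.sum_subset (Finset.range_mono h) fun i _ hi => ?_).symm
    rw [hz i (by simpa using hi)]; simp

theorem tendsto_growthScale_smul_pow_of_lt {T : Module.End ℂ V} {μ : ℂ} (hμ : μ ≠ 0) {R : ℝ}
    (hR : ‖μ‖ < R) (k : ℕ) {v : V} (hv : v ∈ T.maxGenEigenspace μ) :
    Filter.Tendsto (fun m : ℕ => (growthScale R k m : ℂ) • (T ^ m) v) Filter.atTop (𝓝 0) := by
  obtain ⟨K, hK⟩ := (Module.End.mem_maxGenEigenspace T μ v).mp hv
  have h : ∀ i ∈ Finset.range K, Filter.Tendsto (fun m : ℕ => ((growthScale R k m : ℂ) *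
      ((m.choose i : ℂ) * μ ^ m)) • ((μ⁻¹) ^ i • ((T - μ • 1) ^ i) v)) Filter.atTop (𝓝 0) := by
    intro i _
    have h1 : Filter.Tendsto (fun m : ℕ => (growthScale R k m : ℂ) *
      ((m.choose i : ℂ) * μ ^ m)) Filter.atTop (𝓝 0) := by
      rw [tendsto_zero_iff_norm_tendsto_zero]
      refine (tendsto_growthScale_mul_of_lt (norm_nonneg μ) hR k i).congr fun m => ?_
      have := growthScale_pos ((norm_nonneg μ).trans_lt hR) k m
      simp [abs_of_pos this]
    simpa using h1.smul_const ((μ⁻¹) ^ i • ((T - μ • 1) ^ i) v)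
  have h2 := tendsto_finsetSum _ h
  simp only [Finset.sum_const_zero] at h2
  refine h2.congr fun m => ?_
  rw [pow_apply_eq_sum_of_pow_sub_apply_eq_zero hμ hK, Finset.smul_sum]
  exact Finset.sum_congr rfl fun i _ => (smul_smul _ _ _).symm

/-- Terms of index below `k` die, and `m.choose k` is asymptotic to `m ^ k / k!`. The phase `(μ /
‖μ‖) ^ m` need not converge, hence a difference tending to `0` instead of a limit. -/
theorem tendsto_growthScale_smul_pow_sub {T : Module.End ℂ V} {μ : ℂ} (hμ : μ ≠ 0) {k : ℕ} {v : V}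
    (hv : ((T - μ • 1) ^ (k + 1)) v = 0) :
    Filter.Tendsto (fun m : ℕ => (growthScale ‖μ‖ k m : ℂ) • (T ^ m) v -
      (μ / ‖μ‖) ^ m • (((k.factorial : ℂ)⁻¹ * (μ⁻¹) ^ k) • ((T - μ • 1) ^ k) v))
      Filter.atTop (𝓝 0) := by
  have hR : 0 < ‖μ‖ := norm_pos_iff.mpr hμ
  have h : ∀ i ∈ Finset.range k, Filter.Tendsto (fun m : ℕ => ((growthScale ‖μ‖ k m : ℂ) *
      ((m.choose i : ℂ) * μ ^ m)) • ((μ⁻¹) ^ i • ((T - μ • 1) ^ i) v)) Filter.atTop (𝓝 0) := by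
    intro i hi
    have h1 : Filter.Tendsto (fun m : ℕ => (growthScale ‖μ‖ k m : ℂ) *
      ((m.choose i : ℂ) * μ ^ m)) Filter.atTop (𝓝 0) := by
      rw [tendsto_zero_iff_norm_tendsto_zero]
      refine (tendsto_growthScale_mul_of_index_lt hR (Finset.mem_range.mp hi)).congr fun m => ?_
      have := growthScale_pos hR k m
      simp [abs_of_pos this]
    simpa using h1.smul_const ((μ⁻¹) ^ i • ((T - μ • 1) ^ i) v)
  have h2 := tendsto_finsetSum _ h
  simp only [Finset.sum_const_zero] at h2
  have h3 : Filter.Tendsto (fun m : ℕ => ((growthScale ‖μ‖ k m : ℂ) *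
      ((m.choose k : ℂ) * μ ^ m)) - (μ / ‖μ‖) ^ m * (k.factorial : ℂ)⁻¹) Filter.atTop (𝓝 0) := by
    rw [tendsto_zero_iff_norm_tendsto_zero]
    have h4 := (tendsto_growthScale_mul_self hR k).sub_const ((k.factorial : ℝ)⁻¹)
    rw [sub_self, tendsto_zero_iff_norm_tendsto_zero] at h4
    refine h4.congr fun m => ?_
    have hμR : (‖μ‖ : ℂ) ≠ 0 := by exact_mod_cast hR.ne'
    have e : ((growthScale ‖μ‖ k m : ℂ) * ((m.choose k : ℂ) * μ ^ m)) -
        (μ / ‖μ‖) ^ m * (k.factorial : ℂ)⁻¹ = (μ / ‖μ‖) ^ m *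
        ((growthScale ‖μ‖ k m * (m.choose k * ‖μ‖ ^ m) - (k.factorial : ℝ)⁻¹ : ℝ) : ℂ) := by
      push_cast
      rw [div_pow]
      field_simp
    rw [e, norm_mul, norm_pow, norm_div, Complex.norm_real, Complex.norm_real, norm_norm,
      div_self hR.ne', one_pow, one_mul]
  have h5 := h2.add (h3.smul_const ((μ⁻¹) ^ k • ((T - μ • 1) ^ k) v))
  rw [zero_smul, add_zero] at h5
  refine h5.congr fun m => ?_
  rw [pow_apply_eq_sum_of_pow_sub_apply_eq_zero hμ hv, Finset.smul_sum, Finset.sum_range_succ,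
    sub_smul, ← add_sub_assoc]
  simp only [smul_smul, mul_assoc]

/-- `R` is the spectral radius of `T`, and `k + 1` is the largest size of a Jordan block of `T`
whose eigenvalue has modulus `R`. -/
structure HasGrowth (T : Module.End ℂ V) (R : ℝ) (k : ℕ) : Prop where
  pos : 0 < R
  norm_le : ∀ μ, T.HasEigenvalue μ → ‖μ‖ ≤ R
  pow_succ_apply_eq_zero : ∀ μ : ℂ, ‖μ‖ = R → ∀ v ∈ T.maxGenEigenspace μ,
    ((T - μ • 1) ^ (k + 1)) v = 0
  exists_pow_apply_ne_zero : ∃ μ : ℂ, ‖μ‖ = R ∧ ∃ v ∈ T.maxGenEigenspace μ,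
    ((T - μ • 1) ^ k) v ≠ 0

theorem hasEigenvalue_of_maxGenEigenspace_ne_bot {T : Module.End ℂ V} {μ : ℂ}
    (h : T.maxGenEigenspace μ ≠ ⊥) : T.HasEigenvalue μ := by
  by_contra hc
  apply h
  rw [Submodule.eq_bot_iff]
  intro v hv
  obtain ⟨K, hK⟩ := (Module.End.mem_maxGenEigenspace T μ v).mp hv
  have hinj : Function.Injective (T - μ • 1 : Module.End ℂ V) := by
    rw [← LinearMap.ker_eq_bot]
    rw [Module.End.hasEigenvalue_iff, not_not, Module.End.eigenspace_def] at hc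
    exact hc
  have : Function.Injective ((T - μ • 1 : Module.End ℂ V) ^ K) := by
    rw [Module.End.coe_pow]; exact hinj.iterate K
  exact this (hK.trans (map_zero _).symm)

theorem exists_hasGrowth [FiniteDimensional ℂ V] [Nontrivial V] {T : Module.End ℂ V}
    (h0 : ¬ T.HasEigenvalue 0) : ∃ R k, HasGrowth T R k := by
  classical
  obtain ⟨μ₀, hμ₀⟩ := Module.End.exists_eigenvalue T
  obtain ⟨μ, hμ, hmax⟩ := (Module.End.finite_hasEigenvalue T).exists_maximalFor
    (fun μ => ‖μ‖) _ ⟨μ₀, hμ₀⟩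
  have hle : ∀ ν, T.HasEigenvalue ν → ‖ν‖ ≤ ‖μ‖ := fun ν hν => by
    rcases le_total ‖ν‖ ‖μ‖ with h | h
    · exact h
    · exact hmax hν h
  let P : ℕ → Prop := fun k => ∀ ν : ℂ, ‖ν‖ = ‖μ‖ → ∀ v ∈ T.maxGenEigenspace ν,
    ((T - ν • 1) ^ k) v = 0
  have hP : ∃ k, P k := by
    refine ⟨Module.finrank ℂ V, fun ν _ v hv => ?_⟩
    rw [Module.End.maxGenEigenspace_eq_genEigenspace_finrank, Module.End.mem_genEigenspace_nat] at hv
    exact hv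
  obtain ⟨u, hu⟩ := hμ.exists_hasEigenvector
  have hu' : u ∈ T.maxGenEigenspace μ :=
    (Module.End.mem_maxGenEigenspace _ _ _).mpr ⟨1, by
      rw [pow_one, LinearMap.sub_apply, hu.apply_eq_smul]; simp⟩
  -- An eigenvector of `μ` is not killed by the zeroth power, so the least exponent that works has
  -- the form `k + 1`.
  have hk0 : Nat.find hP ≠ 0 := by
    intro h
    have h' := Nat.find_spec hP
    rw [h] at h'
    exact hu.2 (h' μ rfl u hu')
  obtain ⟨k, hk⟩ := Nat.exists_eq_succ_of_ne_zero hk0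
  refine ⟨‖μ‖, k, norm_pos_iff.mpr fun h => h0 (h ▸ hμ), hle, ?_, ?_⟩
  · have := Nat.find_spec hP
    rw [hk] at this
    exact this
  · have := Nat.find_min hP (m := k) (by omega)
    simp only [P] at this
    push Not at this
    exact this

namespace HasGrowth

variable {T : Module.End ℂ V} {R : ℝ} {k : ℕ}

/-- The phase has modulus one, so the norm of the rescaled orbit tends to a nonzero multiple of the
norm of `((T - μ • 1) ^ k) v`. -/
theorem tendsto_zero_iff (h : HasGrowth T R k) {μ : ℂ} (hμ : ‖μ‖ = R) {v : V}
    (hv : v ∈ T.maxGenEigenspace μ) :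
    Filter.Tendsto (fun m : ℕ => (growthScale R k m : ℂ) • (T ^ m) v) Filter.atTop (𝓝 0) ↔
      ((T - μ • 1) ^ k) v = 0 := by
  have hμ0 : μ ≠ 0 := norm_pos_iff.mp (hμ ▸ h.pos)
  have h1 := tendsto_growthScale_smul_pow_sub hμ0 (h.pow_succ_apply_eq_zero μ hμ v hv)
  rw [hμ] at h1
  constructor
  · intro h2
    have h3 := (h2.sub h1).norm
    simp only [sub_sub_cancel, sub_zero, norm_zero, norm_smul, norm_pow, norm_div, hμ,
      Complex.norm_real, Real.norm_of_nonneg h.pos.le, div_self h.pos.ne', one_pow, one_mul,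
      norm_mul, norm_inv, tendsto_const_nhds_iff] at h3
    have hf : ‖(k.factorial : ℂ)‖ ≠ 0 := by simp [Nat.factorial_ne_zero]
    have hR := h.pos.ne'
    simpa [hR, Nat.factorial_ne_zero] using h3
  · intro h2
    simpa [h2] using h1

/-- The leading coefficients are eigenvectors because one further factor `T - μ • 1` kills them.
Since eigenspaces are independent, the different phases can later be separated. -/
theorem exists_leading (h : HasGrowth T R k) [FiniteDimensional ℂ V] (h0 : ¬ T.HasEigenvalue 0)
    (v : V) : ∃ (s : Finset ℂ) (u : ℂ → V), (∀ μ ∈ s, ‖μ‖ = R) ∧ (∀ μ, u μ ∈ T.eigenspace μ) ∧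
      Filter.Tendsto (fun m : ℕ => (growthScale R k m : ℂ) • (T ^ m) v -
        ∑ μ ∈ s, (μ / R) ^ m • u μ) Filter.atTop (𝓝 0) := by
  classical
  let s := (Module.End.finite_hasEigenvalue T).toFinset.filter fun μ => ‖μ‖ = R
  refine ⟨s, ?_⟩
  have hs : ∀ μ ∈ s, ‖μ‖ = R := fun μ hμ => (Finset.mem_filter.mp hμ).2
  suffices H : ∃ u : ℂ → V, (∀ μ, u μ ∈ T.eigenspace μ) ∧
      Filter.Tendsto (fun m : ℕ => (growthScale R k m : ℂ) • (T ^ m) v -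
        ∑ μ ∈ s, (μ / R) ^ m • u μ) Filter.atTop (𝓝 0) by
    obtain ⟨u, hu⟩ := H
    exact ⟨u, hs, hu⟩
  have hv : v ∈ ⨆ μ, T.maxGenEigenspace μ := by
    rw [Module.End.iSup_maxGenEigenspace_eq_top]; trivial
  refine Submodule.iSup_induction (motive := fun v => ∃ u : ℂ → V,
    (∀ μ, u μ ∈ T.eigenspace μ) ∧
      Filter.Tendsto (fun m : ℕ => (growthScale R k m : ℂ) • (T ^ m) v -
        ∑ μ ∈ s, (μ / R) ^ m • u μ) Filter.atTop (𝓝 0)) _ hv ?_ ?_ ?_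
  · intro μ v hv
    by_cases hv0 : v = 0
    · exact ⟨0, by simp, by simp [hv0]⟩
    have hμ : T.HasEigenvalue μ := hasEigenvalue_of_maxGenEigenspace_ne_bot fun hb => hv0 (by
      rw [hb] at hv; simpa using hv)
    have hμ0 : μ ≠ 0 := fun e => h0 (e ▸ hμ)
    rcases (h.norm_le μ hμ).lt_or_eq with hlt | heq
    · exact ⟨0, by simp, by simpa using tendsto_growthScale_smul_pow_of_lt hμ0 hlt k hv⟩
    · have hz := h.pow_succ_apply_eq_zero μ heq v hv
      have hmem : μ ∈ s := by simp [s, hμ, heq]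
      refine ⟨Pi.single μ (((k.factorial : ℂ)⁻¹ * (μ⁻¹) ^ k) • ((T - μ • 1) ^ k) v), ?_, ?_⟩
      · intro ν
        by_cases hν : ν = μ
        · subst hν
          rw [Pi.single_eq_same]
          refine Submodule.smul_mem _ _ ?_
          rw [Module.End.eigenspace_def, LinearMap.mem_ker, ← Module.End.mul_apply]
          erw [← pow_succ']
          exact hz
        · rw [Pi.single_eq_of_ne hν]; exact zero_mem _
      · have h1 := tendsto_growthScale_smul_pow_sub hμ0 hz
        rw [heq] at h1
        refine h1.congr fun m => ?_
        rw [Finset.sum_eq_single μ (fun b _ hb => by rw [Pi.single_eq_of_ne hb, smul_zero])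
          (fun hn => absurd hmem hn), Pi.single_eq_same]
  · exact ⟨0, by simp, by simp⟩
  · intro x y hx hy
    obtain ⟨u, hu, hu'⟩ := hx
    obtain ⟨w, hw, hw'⟩ := hy
    refine ⟨u + w, fun μ => add_mem (hu μ) (hw μ), ?_⟩
    have := hu'.add hw'
    rw [add_zero] at this
    refine this.congr fun m => ?_
    simp only [map_add, smul_add, Pi.add_apply, Finset.sum_add_distrib]
    abel

theorem exists_norm_le (h : HasGrowth T R k) [FiniteDimensional ℂ V] (h0 : ¬ T.HasEigenvalue 0)
    (v : V) : ∃ C, ∀ m, ‖(growthScale R k m : ℂ) • (T ^ m) v‖ ≤ C := by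
  obtain ⟨s, u, hs, -, hlim⟩ := h.exists_leading h0 v
  obtain ⟨C, hC⟩ := (Metric.isBounded_range_of_tendsto _ hlim).exists_norm_le
  refine ⟨C + ∑ μ ∈ s, ‖u μ‖, fun m => ?_⟩
  have h1 := hC _ ⟨m, rfl⟩
  have h2 : ‖∑ μ ∈ s, (μ / R) ^ m • u μ‖ ≤ ∑ μ ∈ s, ‖u μ‖ := by
    refine norm_sum_le_of_le _ fun μ hμ => ?_
    rw [norm_smul, norm_pow, norm_div, hs μ hμ, Complex.norm_real, Real.norm_of_nonneg h.pos.le,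
      div_self h.pos.ne', one_pow, one_mul]
  calc _ = ‖((growthScale R k m : ℂ) • (T ^ m) v - ∑ μ ∈ s, (μ / R) ^ m • u μ) +
        ∑ μ ∈ s, (μ / R) ^ m • u μ‖ := by rw [sub_add_cancel]
    _ ≤ _ := (norm_add_le _ _).trans (add_le_add h1 h2)

/-- Along no sequence of exponents can a vector grow slower, unless it does along all. -/
theorem tendsto_zero_of_subseq (h : HasGrowth T R k) [FiniteDimensional ℂ V]
    (h0 : ¬ T.HasEigenvalue 0) {v : V} {φ : ℕ → ℕ} (hφ : Filter.Tendsto φ Filter.atTop Filter.atTop)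
    (hv : Filter.Tendsto (fun j : ℕ => (growthScale R k (φ j) : ℂ) • (T ^ φ j) v) Filter.atTop (𝓝 0)) :
    Filter.Tendsto (fun m : ℕ => (growthScale R k m : ℂ) • (T ^ m) v) Filter.atTop (𝓝 0) := by
  obtain ⟨s, u, hs, hu, hlim⟩ := h.exists_leading h0 v
  have h1 : Filter.Tendsto (fun j : ℕ => ∑ μ ∈ s, (μ / R) ^ φ j • u μ) Filter.atTop (𝓝 0) := by
    have := hv.sub (hlim.comp hφ)
    simpa using this
  have hz : ∀ μ ∈ s, u μ = 0 := by
    classical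
    intro μ hμ
    by_contra hne
    have hind := Module.End.eigenspaces_iSupIndep T μ
    have hnot : u μ ∉ ⨆ ν, ⨆ (_ : ν ≠ μ), T.eigenspace ν := fun hmem =>
      hne (by simpa using (Submodule.disjoint_def.mp hind) _ (hu μ) hmem)
    -- The functional `f` isolates one phase: on the sum its absolute value is `‖f (u μ)‖` for every
    -- `j`, yet it has to tend to `0`.
    obtain ⟨f, hf, hker⟩ := Submodule.exists_le_ker_of_notMem hnot
    have h2 : Filter.Tendsto (fun j : ℕ => f (∑ μ ∈ s, (μ / R) ^ φ j • u μ)) Filter.atTop (𝓝 0) := by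
      have := ((LinearMap.continuous_of_finiteDimensional f).tendsto 0).comp h1
      rwa [map_zero] at this
    have h3 := h2.norm
    have h4 : ∀ j, ‖f (∑ ν ∈ s, (ν / R) ^ φ j • u ν)‖ = ‖f (u μ)‖ := by
      intro j
      rw [map_sum, Finset.sum_eq_single μ]
      · rw [map_smul, norm_smul, norm_pow, norm_div, hs μ hμ, Complex.norm_real,
          Real.norm_of_nonneg h.pos.le, div_self h.pos.ne', one_pow, one_mul]
      · intro ν _ hν
        have : u ν ∈ f.ker := hker (Submodule.mem_iSup_of_mem ν (Submodule.mem_iSup_of_mem hν (hu ν)))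
        rw [map_smul, LinearMap.mem_ker.mp this, smul_zero]
      · exact fun hn => absurd hμ hn
    simp only [h4, norm_zero, tendsto_const_nhds_iff, norm_eq_zero] at h3
    exact hf h3
  refine hlim.congr fun m => ?_
  rw [Finset.sum_eq_zero fun μ hμ => by rw [hz μ hμ, smul_zero], sub_zero]

end HasGrowth

end

/-! ### Slowly growing vectors of an endomorphism and of its inverse. -/

section

variable {V : Type*} [NormedAddCommGroup V] [NormedSpace ℂ V]

/-- The identity `T⁻¹ - μ⁻¹ = -μ⁻¹ T⁻¹ (T - μ)` has commuting factors, and `T⁻¹` is injective.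
Inversion thus preserves generalized eigenspaces and their nilpotency filtration. -/
theorem inv_sub_pow_apply_eq_zero_iff {T T' : Module.End ℂ V} (h : T * T' = 1) (h' : T' * T = 1)
    {μ : ℂ} (hμ : μ ≠ 0) (k : ℕ) (v : V) :
    ((T' - μ⁻¹ • 1) ^ k) v = 0 ↔ ((T - μ • 1) ^ k) v = 0 := by
  have e : T' - μ⁻¹ • 1 = (-μ⁻¹) • (T' * (T - μ • 1)) := by
    rw [mul_sub, h', mul_smul_comm, mul_one, smul_sub, smul_smul, neg_mul, inv_mul_cancel₀ hμ]
    simp only [neg_smul, one_smul]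
    abel
  have hc : Commute T' (T - μ • 1) :=
    Commute.sub_right (h'.trans h.symm) ((Commute.one_right T').smul_right μ)
  rw [e, smul_pow, hc.mul_pow, LinearMap.smul_apply, smul_eq_zero_iff_right (pow_ne_zero k (neg_ne_zero.mpr
    (inv_ne_zero hμ))), Module.End.mul_apply]
  refine ⟨fun hz => ?_, fun hz => by rw [hz, map_zero]⟩
  have h1 : (T ^ k) ((T' ^ k) (((T - μ • 1) ^ k) v)) = ((T - μ • 1) ^ k) v := by
    rw [← Module.End.mul_apply, ← (show Commute T T' from h.trans h'.symm).mul_pow, h, one_pow,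
      Module.End.one_apply]
  rw [← h1, hz, map_zero]

theorem maxGenEigenspace_inv {T T' : Module.End ℂ V} (h : T * T' = 1) (h' : T' * T = 1)
    {μ : ℂ} (hμ : μ ≠ 0) : T'.maxGenEigenspace μ⁻¹ = T.maxGenEigenspace μ := by
  ext v
  simp only [Module.End.mem_maxGenEigenspace, inv_sub_pow_apply_eq_zero_iff h h' hμ]

theorem not_hasEigenvalue_zero_of_mul_eq_one {T T' : Module.End ℂ V} (h' : T' * T = 1) :
    ¬ T.HasEigenvalue 0 := by
  intro h
  obtain ⟨v, hv⟩ := h.exists_hasEigenvector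
  apply hv.2
  rw [← Module.End.one_apply (R := ℂ) v, ← h', Module.End.mul_apply, hv.apply_eq_smul, zero_smul,
    map_zero]

theorem hasEigenvalue_inv {T T' : Module.End ℂ V} (h : T * T' = 1) (h' : T' * T = 1)
    {μ : ℂ} (hμ : T.HasEigenvalue μ) : T'.HasEigenvalue μ⁻¹ := by
  have hμ0 : μ ≠ 0 := fun e => not_hasEigenvalue_zero_of_mul_eq_one h' (e ▸ hμ)
  apply hasEigenvalue_of_maxGenEigenspace_ne_bot
  rw [maxGenEigenspace_inv h h' hμ0]
  exact fun hb => hμ (by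
    rw [eq_bot_iff, ← hb]
    exact (T.genEigenspace μ).monotone le_top)

/-- The vectors on which the powers of `T` grow slower than `R ^ m * (m + 1) ^ k`. -/
def growthSmall (T : Module.End ℂ V) (R : ℝ) (k : ℕ) : Submodule ℂ V where
  carrier := {v | Filter.Tendsto (fun m : ℕ => (growthScale R k m : ℂ) • (T ^ m) v)
    Filter.atTop (𝓝 0)}
  zero_mem' := by simp
  add_mem' {v w} hv hw := by simpa using hv.add hw
  smul_mem' c v hv := by
    have h := Filter.Tendsto.const_smul hv c
    rw [smul_zero] at h
    refine h.congr fun m => ?_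
    rw [map_smul, smul_comm]

theorem mem_growthSmall {T : Module.End ℂ V} {R : ℝ} {k : ℕ} {v : V} :
    v ∈ growthSmall T R k ↔ Filter.Tendsto (fun m : ℕ => (growthScale R k m : ℂ) • (T ^ m) v)
      Filter.atTop (𝓝 0) := Iff.rfl

theorem apply_mem_growthSmall {T : Module.End ℂ V} [FiniteDimensional ℂ V] {R : ℝ} {k : ℕ} {v : V}
    (hv : v ∈ growthSmall T R k) : T v ∈ growthSmall T R k := by
  have h := ((LinearMap.continuous_of_finiteDimensional T).tendsto 0).comp (mem_growthSmall.mp hv)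
  rw [map_zero] at h
  refine h.congr fun m => ?_
  rw [Function.comp_apply, map_smul, ← Module.End.mul_apply, ← Module.End.mul_apply, ← pow_succ']
  rfl

namespace HasGrowth

variable {T T' : Module.End ℂ V} {R R' : ℝ} {k k' : ℕ}

theorem growthSmall_ne_top (h : HasGrowth T R k) : growthSmall T R k ≠ ⊤ := by
  obtain ⟨μ, hμ, v, hv, hne⟩ := h.exists_pow_apply_ne_zero
  exact fun ht => hne ((h.tendsto_zero_iff hμ hv).mp (mem_growthSmall.mp (ht ▸ Submodule.mem_top)))

theorem growthSmall_ne_bot (h : HasGrowth T R k) (hk : k ≠ 0) : growthSmall T R k ≠ ⊥ := by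
  obtain ⟨μ, hμ, v, hv, hne⟩ := h.exists_pow_apply_ne_zero
  have hz := h.pow_succ_apply_eq_zero μ hμ v hv
  intro hb
  apply hne
  have hmem : ((T - μ • 1) ^ k) v ∈ T.maxGenEigenspace μ :=
    (Module.End.mem_maxGenEigenspace _ _ _).mpr ⟨1, by
      rw [← Module.End.mul_apply, ← pow_add, add_comm]; exact hz⟩
  have : ((T - μ • 1) ^ k) v ∈ growthSmall T R k := by
    refine mem_growthSmall.mpr ((h.tendsto_zero_iff hμ hmem).mpr ?_)
    -- For `k ≥ 1` one has `2 * k ≥ k + 1`, so a further `k`-th power kills `((T - μ • 1) ^ k) v`.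
    obtain ⟨l, rfl⟩ := Nat.exists_eq_succ_of_ne_zero hk
    rw [← Module.End.mul_apply, ← pow_add, Nat.succ_add, ← Nat.add_succ, pow_add,
      Module.End.mul_apply, hz, map_zero]
  rw [hb] at this
  simpa using this

/-- `R * R'` is the ratio of the largest to the smallest eigenvalue modulus; the next lemma treats
the case of equality. -/
theorem one_le_mul [FiniteDimensional ℂ V] [Nontrivial V] (h : T * T' = 1) (h' : T' * T = 1)
    (hT : HasGrowth T R k) (hT' : HasGrowth T' R' k') :
    1 ≤ R * R' := by
  obtain ⟨μ, hμ⟩ := Module.End.exists_eigenvalue T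
  have hμ0 : μ ≠ 0 := fun e => not_hasEigenvalue_zero_of_mul_eq_one h' (e ▸ hμ)
  have h1 := hT.norm_le μ hμ
  have h2 := hT'.norm_le _ (hasEigenvalue_inv h h' hμ)
  calc (1 : ℝ) = ‖μ‖ * ‖μ⁻¹‖ := by rw [← norm_mul, mul_inv_cancel₀ hμ0, norm_one]
    _ ≤ _ := mul_le_mul h1 h2 (norm_nonneg _) hT.pos.le

theorem norm_eq_of_mul_eq_one (h : T * T' = 1) (h' : T' * T = 1)
    (hT : HasGrowth T R k) (hT' : HasGrowth T' R' k') (hR : R * R' = 1) {μ : ℂ}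
    (hμ : T.HasEigenvalue μ) : ‖μ‖ = R := by
  have hμ0 : 0 < ‖μ‖ :=
    norm_pos_iff.mpr fun e => not_hasEigenvalue_zero_of_mul_eq_one h' (e ▸ hμ)
  refine le_antisymm (hT.norm_le μ hμ) ?_
  have h2 := hT'.norm_le _ (hasEigenvalue_inv h h' hμ)
  rw [norm_inv, inv_le_iff_one_le_mul₀ hμ0] at h2
  rw [← mul_le_mul_iff_left₀ hT'.pos, hR, mul_comm]
  exact h2

/-- A dominant generalized eigenvector of `T'` belongs, for `T`, to an eigenvalue of modulus `1 / R'
< R`, and is therefore negligible there. -/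
theorem exists_mem_growthSmall_notMem_inv (h : T * T' = 1) (h' : T' * T = 1)
    (hT' : HasGrowth T' R' k') (hR : 1 < R * R') :
    ∃ v ∈ growthSmall T R k, v ∉ growthSmall T' R' k' := by
  obtain ⟨μ, hμ, v, hv, hne⟩ := hT'.exists_pow_apply_ne_zero
  have hμ0 : μ ≠ 0 := norm_pos_iff.mp (hμ ▸ hT'.pos)
  refine ⟨v, ?_, fun hm => hne ((hT'.tendsto_zero_iff hμ hv).mp (mem_growthSmall.mp hm))⟩
  refine mem_growthSmall.mpr (tendsto_growthScale_smul_pow_of_lt (inv_ne_zero hμ0) ?_ k ?_)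
  · rw [norm_inv, hμ, inv_lt_iff_one_lt_mul₀ hT'.pos]; exact hR
  · rwa [maxGenEigenspace_inv h' h hμ0]

theorem inv_of_forall_norm_eq_one (h : T * T' = 1) (h' : T' * T = 1) (hT : HasGrowth T R k)
    (h1 : ∀ μ, T.HasEigenvalue μ → ‖μ‖ = 1) : R = 1 ∧ HasGrowth T' R k := by
  obtain ⟨μ, hμ, v, hv, hne⟩ := hT.exists_pow_apply_ne_zero
  have hR : R = 1 := by
    rw [← hμ]
    refine h1 μ (hasEigenvalue_of_maxGenEigenspace_ne_bot fun hb => hne ?_)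
    rw [hb, Submodule.mem_bot] at hv
    rw [hv, map_zero]
  subst hR
  refine ⟨rfl, one_pos, fun ν hν => ?_, fun ν hν w hw => ?_, ?_⟩
  · have := h1 _ (hasEigenvalue_inv h' h hν)
    rw [norm_inv, inv_eq_one] at this
    exact this.le
  · have hν0 : ν ≠ 0 := norm_ne_zero_iff.mp (by rw [hν]; exact one_ne_zero)
    rw [← inv_sub_pow_apply_eq_zero_iff h' h hν0]
    refine hT.pow_succ_apply_eq_zero _ (by rw [norm_inv, hν, inv_one]) w ?_
    rwa [maxGenEigenspace_inv h' h hν0]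
  · have hμ0 : μ ≠ 0 := norm_ne_zero_iff.mp (by rw [hμ]; exact one_ne_zero)
    refine ⟨μ⁻¹, by rw [norm_inv, hμ, inv_one], v, ?_, ?_⟩
    · rwa [maxGenEigenspace_inv h h' hμ0]
    · rwa [Ne, inv_sub_pow_apply_eq_zero_iff h h' hμ0]

/-- An invariant subspace is the sum of its intersections with the generalized eigenspaces. On each
of these, growing slowly means `(T - μ) ^ k v = 0`, a condition that is symmetric under inversion.
-/
theorem growthSmall_le_inv [FiniteDimensional ℂ V] (h : T * T' = 1) (h' : T' * T = 1)
    (hT : HasGrowth T R k) (h1 : ∀ μ, T.HasEigenvalue μ → ‖μ‖ = 1) :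
    growthSmall T R k ≤ growthSmall T' R k := by
  obtain ⟨rfl, hT'⟩ := inv_of_forall_norm_eq_one h h' hT h1
  have h2 := Submodule.inf_iSup_genEigenspace
    (p := growthSmall T 1 k) (f := T) (fun x hx => apply_mem_growthSmall hx) ⊤
  have h3 : ⨆ μ, T.genEigenspace μ ⊤ = ⊤ := Module.End.iSup_maxGenEigenspace_eq_top T
  rw [h3, inf_top_eq] at h2
  rw [h2, iSup_le_iff]
  rintro μ v ⟨hv, hvμ⟩
  have hvμ : v ∈ T.maxGenEigenspace μ := hvμ
  by_cases hv0 : v = 0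
  · rw [hv0]; exact zero_mem _
  have hμ : T.HasEigenvalue μ := hasEigenvalue_of_maxGenEigenspace_ne_bot fun hb => hv0 (by
    rw [hb] at hvμ; simpa using hvμ)
  have hμ1 := h1 μ hμ
  have hμ0 : μ ≠ 0 := norm_ne_zero_iff.mp (by rw [hμ1]; exact one_ne_zero)
  have h4 := (hT.tendsto_zero_iff hμ1 hvμ).mp hv
  rw [← inv_sub_pow_apply_eq_zero_iff h h' hμ0] at h4
  rw [← maxGenEigenspace_inv h h' hμ0] at hvμ
  exact (hT'.tendsto_zero_iff (by rw [norm_inv, hμ1, inv_one]) hvμ).mpr h4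

theorem growthSmall_eq_inv [FiniteDimensional ℂ V] (h : T * T' = 1) (h' : T' * T = 1)
    (hT : HasGrowth T R k) (h1 : ∀ μ, T.HasEigenvalue μ → ‖μ‖ = 1) :
    growthSmall T R k = growthSmall T' R k := by
  refine le_antisymm (growthSmall_le_inv h h' hT h1)
    (growthSmall_le_inv h' h (inv_of_forall_norm_eq_one h h' hT h1).2 fun μ hμ => ?_)
  have := h1 _ (hasEigenvalue_inv h' h hμ)
  rwa [norm_inv, inv_eq_one] at this

theorem iSup_eigenspace_eq_top [FiniteDimensional ℂ V] (hT : HasGrowth T R 0)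
    (h1 : ∀ μ, T.HasEigenvalue μ → ‖μ‖ = R) : ⨆ μ, T.eigenspace μ = ⊤ := by
  rw [eq_top_iff, ← Module.End.iSup_maxGenEigenspace_eq_top T]
  refine iSup_mono fun μ v hv => ?_
  by_cases hv0 : v = 0
  · rw [hv0]; exact zero_mem _
  have hμ : T.HasEigenvalue μ := hasEigenvalue_of_maxGenEigenspace_ne_bot fun hb => hv0 (by
    rw [hb] at hv; simpa using hv)
  have := hT.pow_succ_apply_eq_zero μ (h1 μ hμ) v hv
  rw [zero_add, pow_one] at this
  rwa [Module.End.eigenspace_def, LinearMap.mem_ker]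

/-- For a nonzero slow vector `v`, the bound `‖v‖ = ‖T' ^ m (T ^ m v)‖ ≤ C * ‖T ^ m v‖` forces the
scale itself to tend to `0`. Bounded powers then make every vector slow, which is impossible. -/
theorem growthSmall_eq_bot_of_bounded (h' : T' * T = 1) (h : T * T' = 1) (hT : HasGrowth T R k)
    {C : ℝ} (hC : ∀ m v, ‖(T ^ m) v‖ ≤ C * ‖v‖) (hC' : ∀ m v, ‖(T' ^ m) v‖ ≤ C * ‖v‖) :
    growthSmall T R k = ⊥ := by
  rw [Submodule.eq_bot_iff]
  intro v hv
  by_contra hv0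
  apply hT.growthSmall_ne_top
  have hvn : 0 < ‖v‖ := norm_pos_iff.mpr hv0
  have hpos : ∀ m, ‖(growthScale R k m : ℂ)‖ = growthScale R k m := fun m => by
    rw [Complex.norm_real, Real.norm_of_nonneg (growthScale_pos hT.pos k m).le]
  have h1 := (mem_growthSmall.mp hv).norm
  rw [norm_zero] at h1
  have h2 : Filter.Tendsto (fun m => growthScale R k m) Filter.atTop (𝓝 0) := by
    have h3 := (h1.const_mul (C / ‖v‖))
    rw [mul_zero] at h3
    refine squeeze_zero (fun m => (growthScale_pos hT.pos k m).le) (fun m => ?_) h3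
    have h4 := hC' m ((T ^ m) v)
    rw [← Module.End.mul_apply, ← (show Commute T' T from h'.trans h.symm).mul_pow, h', one_pow,
      Module.End.one_apply] at h4
    rw [norm_smul, hpos, div_mul_eq_mul_div, le_div_iff₀ hvn]
    calc _ ≤ growthScale R k m * (C * ‖(T ^ m) v‖) :=
          mul_le_mul_of_nonneg_left h4 (growthScale_pos hT.pos k m).le
      _ = _ := by ring
  rw [Submodule.eq_top_iff']
  intro w
  rw [mem_growthSmall, tendsto_zero_iff_norm_tendsto_zero]
  have h3 := h2.mul_const (C * ‖w‖)
  rw [zero_mul] at h3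
  refine squeeze_zero (fun m => norm_nonneg _) (fun m => ?_) h3
  rw [norm_smul, hpos]
  exact mul_le_mul_of_nonneg_left (hC m w) (growthScale_pos hT.pos k m).le

end HasGrowth

end

/-! ### Limits of projective transformations -/

namespace HProj

variable {n : ℕ}

open Classical in
/-- The point of `ℙ^n_ℍ` represented by a nonzero vector; arbitrary at `0`. -/
noncomputable def ofVec (v : VecH n) : HProj n :=
  if hv : v ≠ 0 then Projectivization.mk ℍ[ℝ]ᵐᵒᵖ v hv
  else Projectivization.mk ℍ[ℝ]ᵐᵒᵖ (1 : VecH n) one_ne_zero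

theorem ofVec_of_ne {v : VecH n} (hv : v ≠ 0) : ofVec v = Projectivization.mk ℍ[ℝ]ᵐᵒᵖ v hv :=
  dif_pos hv

theorem exists_ofVec_eq (p : HProj n) : ∃ v : VecH n, v ≠ 0 ∧ ofVec v = p :=
  ⟨p.rep, p.rep_nonzero, by rw [ofVec_of_ne p.rep_nonzero, Projectivization.mk_rep]⟩

theorem ofVec_smul {t : ℍ[ℝ]ᵐᵒᵖ} (ht : t ≠ 0) (v : VecH n) : ofVec (t • v) = ofVec v := by
  by_cases hv : v = 0
  · rw [hv, smul_zero]
  · rw [ofVec_of_ne hv, ofVec_of_ne (smul_ne_zero ht hv)]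
    exact (Projectivization.mk_eq_mk_iff' _ _ _ _ _).mpr ⟨t, rfl⟩

theorem real_smul_eq (c : ℝ) (v : VecH n) : c • v = MulOpposite.op (c : ℍ[ℝ]) • v := by
  funext i
  simp [Quaternion.mul_coe_eq_smul]

theorem ofVec_real_smul {c : ℝ} (hc : c ≠ 0) (v : VecH n) : ofVec (c • v) = ofVec v := by
  rw [real_smul_eq]
  refine ofVec_smul (fun h => hc ?_) v
  have := congrArg (fun t => (MulOpposite.unop t).re) h
  simpa using this

theorem ofVec_eq_ofVec_iff {v w : VecH n} (hv : v ≠ 0) (hw : w ≠ 0) :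
    ofVec v = ofVec w ↔ ∃ t : ℍ[ℝ]ᵐᵒᵖ, t • w = v := by
  rw [ofVec_of_ne hv, ofVec_of_ne hw, Projectivization.mk_eq_mk_iff']

theorem isOpenMap_mk' (n : ℕ) :
    IsOpenMap (Projectivization.mk' ℍ[ℝ]ᵐᵒᵖ : {v : VecH n // v ≠ 0} → HProj n) := by
  intro O hO
  refine isOpen_coinduced.mpr ?_
  have h : (Projectivization.mk' ℍ[ℝ]ᵐᵒᵖ : {v : VecH n // v ≠ 0} → HProj n) ⁻¹'
      (Projectivization.mk' ℍ[ℝ]ᵐᵒᵖ '' O) =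
      ⋃ t : ℍ[ℝ]ᵐᵒᵖˣ, (fun v : {v : VecH n // v ≠ 0} =>
        (⟨(t : ℍ[ℝ]ᵐᵒᵖ) • v.1, smul_ne_zero t.ne_zero v.2⟩ : {v : VecH n // v ≠ 0})) ⁻¹' O := by
    ext v
    simp only [Set.mem_preimage, Set.mem_image, Set.mem_iUnion]
    constructor
    · rintro ⟨w, hw, hwv⟩
      obtain ⟨t, ht⟩ := (Projectivization.mk_eq_mk_iff _ _ _ w.2 v.2).mp hwv
      refine ⟨t, ?_⟩
      convert hw using 1
      exact Subtype.ext ht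
    · rintro ⟨t, ht⟩
      exact ⟨_, ht, (Projectivization.mk_eq_mk_iff _ _ _ _ _).mpr ⟨t, rfl⟩⟩
  rw [h]
  refine isOpen_iUnion fun t => hO.preimage ?_
  exact (continuous_subtype_val.const_smul (t : ℍ[ℝ]ᵐᵒᵖ)).subtype_mk _

/-- Because the quotient map is open, convergence at a point of projective space can be tested on
vectors near a representative. -/
theorem map_ofVec_nhds {v : VecH n} (hv : v ≠ 0) : Filter.map ofVec (𝓝 v) = 𝓝 (ofVec v) := by
  have h1 : Filter.map (Subtype.val : {v : VecH n // v ≠ 0} → VecH n) (𝓝 ⟨v, hv⟩) = 𝓝 v :=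
    isOpen_ne.isOpenEmbedding_subtypeVal.map_nhds_eq _
  have h2 : (ofVec ∘ Subtype.val : {v : VecH n // v ≠ 0} → HProj n) =
      Projectivization.mk' ℍ[ℝ]ᵐᵒᵖ := funext fun w => ofVec_of_ne w.2
  rw [← h1, Filter.map_map, h2, ofVec_of_ne hv]
  exact le_antisymm (continuous_mk' n).continuousAt ((isOpenMap_mk' n).nhds_le _)

theorem continuousAt_ofVec {v : VecH n} (hv : v ≠ 0) : ContinuousAt ofVec v :=
  (map_ofVec_nhds hv).le

theorem ofVec_mulVec_rep (M : MatH n) {w : VecH n} (hw : w ≠ 0) :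
    ofVec (M *ᵥ (ofVec w).rep) = ofVec (M *ᵥ w) := by
  have h0 := Projectivization.rep_nonzero (ofVec w)
  have h1 : ofVec w = ofVec (ofVec w).rep := by rw [ofVec_of_ne h0, Projectivization.mk_rep]
  obtain ⟨t, ht⟩ := (ofVec_eq_ofVec_iff hw h0).mp h1
  have ht0 : t ≠ 0 := by
    rintro rfl
    exact hw (by rw [← ht, zero_smul])
  have h2 : M *ᵥ w = t • (M *ᵥ (ofVec w).rep) := by rw [← Matrix.mulVec_smul, ht]
  rw [h2, ofVec_smul ht0]

/-- A diagonal entry of `toMat` is a continuous function that cuts out a coordinate hyperplane; it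
serves to tell limits apart. -/
theorem toMat_ofVec_eq_zero_iff {v : VecH n} (hv : v ≠ 0) (i : Fin (n + 1)) :
    toMat (ofVec v) i i = 0 ↔ v i = 0 := by
  rw [ofVec_of_ne hv]
  change (∑ k, Quaternion.normSq (v k))⁻¹ • (v i * star (v i)) = 0 ↔ _
  rw [smul_eq_zero_iff_right (inv_ne_zero (sum_normSq_ne_zero hv))]
  simp

end HProj

/-! ### Normality of families of powers, read off from limits of rescaled matrices. -/

section

variable {n : ℕ}

theorem tendsto_mulVec {α : Type*} {l : Filter α} {B : α → MatH n} {M : MatH n} {x : α → VecH n}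
    {v : VecH n} (hB : Filter.Tendsto B l (𝓝 M)) (hx : Filter.Tendsto x l (𝓝 v)) :
    Filter.Tendsto (fun a => B a *ᵥ x a) l (𝓝 (M *ᵥ v)) := by
  rw [tendsto_pi_nhds]
  intro i
  simp only [Matrix.mulVec_eq_sum, Finset.sum_apply, Pi.smul_apply, MulOpposite.smul_eq_mul_unop,
    MulOpposite.unop_op, Matrix.transpose_apply]
  exact tendsto_finsetSum _ fun k _ => (((continuous_apply_apply i k).tendsto M).comp hB).mul
    (((continuous_apply k).tendsto v).comp hx)

theorem mulVec_units_ne_zero (A : (MatH n)ˣ) {v : VecH n} (hv : v ≠ 0) : (A : MatH n) *ᵥ v ≠ 0 := by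
  intro h
  apply hv
  rw [← Matrix.one_mulVec v, ← Units.inv_mul A, ← Matrix.mulVec_mulVec, h, Matrix.mulVec_zero]

theorem pslhAction_mk_ofVec (A : ↥(SLH n)) {v : VecH n} (hv : v ≠ 0) :
    pslhAction n (QuotientGroup.mk A) (HProj.ofVec v) =
      HProj.ofVec (((A : (MatH n)ˣ) : MatH n) *ᵥ v) := by
  rw [HProj.ofVec_of_ne hv, HProj.ofVec_of_ne (mulVec_units_ne_zero _ hv)]
  rfl

theorem pslhAction_zpow_ofVec (A : ↥(SLH n)) (m : ℤ) {c : ℝ} (hc : c ≠ 0) {v : VecH n} (hv : v ≠ 0) :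
    pslhAction n ((QuotientGroup.mk A : PSLH n) ^ m) (HProj.ofVec v) =
      HProj.ofVec ((c • (((A : (MatH n)ˣ) ^ m : (MatH n)ˣ) : MatH n)) *ᵥ v) := by
  rw [← QuotientGroup.mk_zpow, pslhAction_mk_ofVec _ hv, Matrix.smul_mulVec,
    HProj.ofVec_real_smul hc, SubgroupClass.coe_zpow]

theorem continuous_pslhAction (γ : PSLH n) : Continuous (pslhAction n γ) := by
  obtain ⟨A, rfl⟩ := QuotientGroup.mk_surjective γ
  rw [continuous_iff_continuousAt]
  intro p
  obtain ⟨v, hv, rfl⟩ := HProj.exists_ofVec_eq p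
  have hne : ∀ᶠ w in 𝓝 v, w ≠ 0 := isOpen_ne.mem_nhds hv
  rw [ContinuousAt, ← HProj.map_ofVec_nhds hv, Filter.tendsto_map'_iff, pslhAction_mk_ofVec _ hv]
  have hc : Continuous fun w : VecH n => ((A : (MatH n)ˣ) : MatH n) *ᵥ w :=
    Continuous.matrix_mulVec continuous_const continuous_id
  refine ((HProj.continuousAt_ofVec (mulVec_units_ne_zero _ hv)).tendsto.comp
    hc.continuousAt).congr' ?_
  filter_upwards [hne] with w hw
  exact (pslhAction_mk_ofVec A hw).symm

/-- Real factors do not affect the projective maps, and `(B, v) ↦ [B v]` is continuous wherever `B v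
≠ 0`. So convergence of the rescaled matrices to a possibly singular `M` gives locally uniform
convergence off the kernel of `M`. -/
theorem subset_eqRegion_zpowers (A : ↥(SLH n)) {U : Set (HProj n)} (hU : IsOpen U)
    (h : ∀ m : ℕ → ℤ, ∃ φ : ℕ → ℕ, StrictMono φ ∧ ∃ c : ℕ → ℝ, (∀ j, c j ≠ 0) ∧ ∃ M : MatH n,
      (∀ v : VecH n, v ≠ 0 → HProj.ofVec v ∈ U → M *ᵥ v ≠ 0) ∧
      Filter.Tendsto (fun j => c j • (((A : (MatH n)ˣ) ^ m (φ j) : (MatH n)ˣ) : MatH n))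
        Filter.atTop (𝓝 M)) :
    U ⊆ eqRegion (Subgroup.zpowers (QuotientGroup.mk A : PSLH n)) := by
  intro z hz
  refine ⟨U, hU, hz, fun f hf => ?_⟩
  have hf' : ∀ j, ∃ m : ℤ, f j = fun x : U => pslhAction n ((QuotientGroup.mk A : PSLH n) ^ m) x := by
    intro j
    obtain ⟨g, ⟨m, rfl⟩, hg⟩ := hf j
    exact ⟨m, hg⟩
  choose m hm using hf'
  obtain ⟨φ, hφ, c, hc, M, hM, hlim⟩ := h m
  refine ⟨φ, hφ, fun x => HProj.ofVec (M *ᵥ x.1.rep), fun K hK => ?_⟩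
  suffices H : TendstoLocallyUniformly (fun j => f (φ j))
      (fun x : U => HProj.ofVec (M *ᵥ x.1.rep)) Filter.atTop from
    (tendstoLocallyUniformlyOn_iff_tendstoUniformlyOn_of_compact hK).mp H.tendstoLocallyUniformlyOn
  rw [tendstoLocallyUniformly_iff_forall_tendsto]
  intro x
  obtain ⟨v, hv, hvx⟩ := HProj.exists_ofVec_eq x.1
  have hMv : M *ᵥ v ≠ 0 := hM v hv (hvx ▸ x.2)
  suffices H : Filter.Tendsto (fun y : ℕ × HProj n => (HProj.ofVec (M *ᵥ y.2.rep),
      pslhAction n ((QuotientGroup.mk A : PSLH n) ^ m (φ y.1)) y.2)) (Filter.atTop ×ˢ 𝓝 x.1)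
      (uniformity (HProj n)) by
    have h1 : Filter.Tendsto (Prod.map id Subtype.val : ℕ × U → ℕ × HProj n)
        (Filter.atTop ×ˢ 𝓝 x) (Filter.atTop ×ˢ 𝓝 x.1) :=
      Filter.tendsto_id.prodMap continuous_subtype_val.continuousAt
    refine (H.comp h1).congr fun y => ?_
    simp [hm]
  have hmap : (Filter.atTop ×ˢ 𝓝 x.1 : Filter (ℕ × HProj n)) =
      Filter.map (Prod.map id HProj.ofVec) (Filter.atTop ×ˢ 𝓝 v) := by
    rw [← hvx, ← HProj.map_ofVec_nhds hv, ← Filter.prod_map_map_eq', Filter.map_id]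
  rw [hmap, Filter.tendsto_map'_iff]
  -- Both components converge to the same point `[M v]`, and neighborhoods of a diagonal point
  -- refine the uniformity.
  refine Filter.Tendsto.mono_right ?_ (nhds_le_uniformity (HProj.ofVec (M *ᵥ v)))
  rw [nhds_prod_eq]
  have hne : ∀ᶠ y : ℕ × VecH n in Filter.atTop ×ˢ 𝓝 v, y.2 ≠ 0 :=
    Filter.tendsto_snd.eventually (isOpen_ne.mem_nhds hv)
  refine Filter.Tendsto.prodMk ?_ ?_
  · have h1 : Filter.Tendsto (fun y : ℕ × VecH n => HProj.ofVec (M *ᵥ y.2)) (Filter.atTop ×ˢ 𝓝 v)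
        (𝓝 (HProj.ofVec (M *ᵥ v))) :=
      (HProj.continuousAt_ofVec hMv).tendsto.comp (tendsto_mulVec tendsto_const_nhds
        Filter.tendsto_snd)
    refine h1.congr' ?_
    filter_upwards [hne] with y hy
    exact (HProj.ofVec_mulVec_rep M hy).symm
  · have h1 : Filter.Tendsto (fun y : ℕ × VecH n => HProj.ofVec
        ((c y.1 • (((A : (MatH n)ˣ) ^ m (φ y.1) : (MatH n)ˣ) : MatH n)) *ᵥ y.2))
        (Filter.atTop ×ˢ 𝓝 v) (𝓝 (HProj.ofVec (M *ᵥ v))) := by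
      exact (HProj.continuousAt_ofVec hMv).tendsto.comp
        (tendsto_mulVec (hlim.comp Filter.tendsto_fst) Filter.tendsto_snd)
    refine h1.congr' ?_
    filter_upwards [hne] with y hy
    exact (pslhAction_zpow_ofVec A _ (hc y.1) hy).symm

/-- Locally uniform convergence to a continuous limit is continuous convergence. The point is that
`p` does not depend on the sequence `x` approaching `v`. -/
theorem tendsto_of_mem_eqRegion_zpowers {A : ↥(SLH n)} {v : VecH n} (hv : v ≠ 0)
    (hz : HProj.ofVec v ∈ eqRegion (Subgroup.zpowers (QuotientGroup.mk A : PSLH n))) (m : ℕ → ℤ)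
    {c : ℕ → ℝ} (hc : ∀ j, c j ≠ 0) :
    ∃ φ : ℕ → ℕ, StrictMono φ ∧ ∃ p : HProj n, ∀ x : ℕ → VecH n,
      Filter.Tendsto x Filter.atTop (𝓝 v) → Filter.Tendsto (fun j => HProj.ofVec
        ((c (φ j) • (((A : (MatH n)ˣ) ^ m (φ j) : (MatH n)ˣ) : MatH n)) *ᵥ x j))
        Filter.atTop (𝓝 p) := by
  classical
  obtain ⟨U, hU, hzU, hnorm⟩ := hz
  obtain ⟨φ, hφ, g, hg⟩ := hnorm
    (fun j x => pslhAction n ((QuotientGroup.mk A : PSLH n) ^ m j) x)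
    (fun j => ⟨_, ⟨m j, rfl⟩, rfl⟩)
  have : LocallyCompactSpace U := hU.locallyCompactSpace
  have hloc := tendstoLocallyUniformly_iff_forall_isCompact.mpr hg
  have hgc : Continuous g := hloc.continuous (Filter.Frequently.of_forall fun j =>
    (continuous_pslhAction _).comp continuous_subtype_val)
  refine ⟨φ, hφ, g ⟨_, hzU⟩, fun x hx => ?_⟩
  have hx' : Filter.Tendsto (fun j => HProj.ofVec (x j)) Filter.atTop (𝓝 (HProj.ofVec v)) :=
    (HProj.continuousAt_ofVec hv).tendsto.comp hx
  have hxU : ∀ᶠ j in Filter.atTop, HProj.ofVec (x j) ∈ U := hx'.eventually (hU.mem_nhds hzU)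
  -- Finitely many terms may lie outside `U`; they are replaced by the base point.
  let y : ℕ → U := fun j => if h : HProj.ofVec (x j) ∈ U then ⟨_, h⟩ else ⟨_, hzU⟩
  have hy : Filter.Tendsto y Filter.atTop (𝓝 ⟨_, hzU⟩) := by
    rw [tendsto_subtype_rng]
    refine hx'.congr' ?_
    filter_upwards [hxU] with j hj
    simp [y, hj]
  have h1 := hloc.tendsto_comp hgc.continuousAt hy
  refine h1.congr' ?_
  filter_upwards [hxU, hx.eventually (isOpen_ne.mem_nhds hv)] with j hj hj0
  simp only [y, hj, dif_pos]
  exact pslhAction_zpow_ofVec A _ (hc _) hj0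

/-- Normality at `v` would give one common limit for all approaches to `v`. Approaching along `w`
slowly compared with the decay of `B j *ᵥ v` yields `[M w]`. Correcting `v` by a small quaternionic
multiple of `w` that cancels the `i`-th coordinate yields a limit in the hyperplane where that
coordinate vanishes, which misses `[M w]`. -/
theorem ofVec_notMem_eqRegion_zpowers {A : ↥(SLH n)} {m : ℕ → ℤ} {c : ℕ → ℝ} (hc : ∀ j, c j ≠ 0)
    {M : MatH n} (hM : M ≠ 0)
    (hlim : Filter.Tendsto (fun j => c j • (((A : (MatH n)ˣ) ^ m j : (MatH n)ˣ) : MatH n))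
        Filter.atTop (𝓝 M)) {v : VecH n} (hv : v ≠ 0) (hMv : M *ᵥ v = 0) :
    HProj.ofVec v ∉ eqRegion (Subgroup.zpowers (QuotientGroup.mk A : PSLH n)) := by
  intro hz
  obtain ⟨φ, hφ, p, hp⟩ := tendsto_of_mem_eqRegion_zpowers hv hz m hc
  set B : ℕ → MatH n := fun j => c (φ j) • (((A : (MatH n)ˣ) ^ m (φ j) : (MatH n)ˣ) : MatH n) with hB
  have hBlim : Filter.Tendsto B Filter.atTop (𝓝 M) := hlim.comp hφ.tendsto_atTop
  have hBv : ∀ w : VecH n, Filter.Tendsto (fun j => B j *ᵥ w) Filter.atTop (𝓝 (M *ᵥ w)) := fun w =>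
    tendsto_mulVec hBlim tendsto_const_nhds
  have hB0 : ∀ j (w : VecH n), w ≠ 0 → B j *ᵥ w ≠ 0 := fun j w hw => by
    rw [hB, Matrix.smul_mulVec]
    exact smul_ne_zero (hc _) (mulVec_units_ne_zero _ hw)
  obtain ⟨i, l, hil⟩ : ∃ i l, M i l ≠ 0 := by
    by_contra! hcon
    exact hM (Matrix.ext hcon)
  set w : VecH n := Pi.single l 1 with hw
  have hMw : (M *ᵥ w) i ≠ 0 := by rw [hw, Matrix.mulVec_single_one]; exact hil
  have hMw0 : M *ᵥ w ≠ 0 := fun h => hMw (by rw [h]; rfl)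
  have hv0 := hBv v
  rw [hMv] at hv0
  -- points that approach `v` slowly are moved towards `M w`
  have hp1 : p = HProj.ofVec (M *ᵥ w) := by
    -- The square root makes both `t j` and `‖B j *ᵥ v‖ / t j` tend to `0`; the added term makes
    -- positivity immediate.
    let t : ℕ → ℝ := fun j => Real.sqrt ‖B j *ᵥ v‖ + 1 / ((j : ℝ) + 1)
    have ht0 : ∀ j, 0 < t j := fun j => by positivity
    have ht : Filter.Tendsto t Filter.atTop (𝓝 0) := by
      have := (Real.continuous_sqrt.tendsto _).comp hv0.norm
      rw [norm_zero, Real.sqrt_zero] at this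
      simpa [t] using this.add (tendsto_one_div_add_atTop_nhds_zero_nat (𝕜 := ℝ))
    have hx : Filter.Tendsto (fun j => v + t j • w) Filter.atTop (𝓝 v) := by
      simpa only [zero_smul, add_zero] using (ht.smul_const w).const_add v
    refine tendsto_nhds_unique (hp _ hx) ?_
    have h1 : Filter.Tendsto (fun j => (t j)⁻¹ • (B j *ᵥ v) + B j *ᵥ w) Filter.atTop
        (𝓝 (M *ᵥ w)) := by
      have h2 : Filter.Tendsto (fun j => (t j)⁻¹ • (B j *ᵥ v)) Filter.atTop (𝓝 0) := by
        rw [tendsto_zero_iff_norm_tendsto_zero]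
        refine squeeze_zero (fun j => norm_nonneg _) (fun j => ?_) ht
        rw [norm_smul, norm_inv, Real.norm_of_nonneg (ht0 j).le, inv_mul_le_iff₀ (ht0 j)]
        have h3 : Real.sqrt ‖B j *ᵥ v‖ ≤ t j := le_add_of_nonneg_right (by positivity)
        calc _ = Real.sqrt ‖B j *ᵥ v‖ * Real.sqrt ‖B j *ᵥ v‖ :=
              (Real.mul_self_sqrt (norm_nonneg _)).symm
          _ ≤ _ := mul_self_le_mul_self (Real.sqrt_nonneg _) h3
      simpa using h2.add (hBv w)
    refine ((HProj.continuousAt_ofVec hMw0).tendsto.comp h1).congr fun j => ?_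
    have e : B j *ᵥ (v + t j • w) = t j • ((t j)⁻¹ • (B j *ᵥ v) + B j *ᵥ w) := by
      rw [smul_add, smul_smul, mul_inv_cancel₀ (ht0 j).ne', one_smul, Matrix.mulVec_add,
        Matrix.mulVec_smul]
    change _ = HProj.ofVec (B j *ᵥ (v + t j • w))
    rw [e, HProj.ofVec_real_smul (ht0 j).ne', Function.comp_apply]
  -- points that approach `v` suitably are moved into a hyperplane that does not contain `M w`
  let q : ℕ → ℍ[ℝ] := fun j => -(((B j *ᵥ w) i)⁻¹ * (B j *ᵥ v) i)
  have hi : ∀ u : VecH n, Filter.Tendsto (fun j => (B j *ᵥ u) i) Filter.atTop (𝓝 ((M *ᵥ u) i)) :=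
    fun u => ((continuous_apply i).tendsto _).comp (hBv u)
  have hq : Filter.Tendsto q Filter.atTop (𝓝 0) := by
    have := (((hi w).inv₀ hMw).mul (hi v)).neg
    rwa [hMv, Pi.zero_apply, mul_zero, neg_zero] at this
  have hx : Filter.Tendsto (fun j => v + MulOpposite.op (q j) • w) Filter.atTop (𝓝 v) := by
    have h1 : Filter.Tendsto (fun j => MulOpposite.op (q j) • w) Filter.atTop (𝓝 0) := by
      have := ((MulOpposite.continuous_op.tendsto _).comp hq).smul_const w
      simpa using this
    simpa using h1.const_add v
  have h1 := ((HProj.continuous_toMat n).tendsto p).comp (hp _ hx)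
  have h2 : Filter.Tendsto (fun j => HProj.toMat (HProj.ofVec
      (B j *ᵥ (v + MulOpposite.op (q j) • w))) i i) Filter.atTop (𝓝 (HProj.toMat p i i)) :=
    ((continuous_apply_apply i i).tendsto (HProj.toMat p : MatH n)).comp h1
  have h3 : HProj.toMat p i i = 0 := by
    refine tendsto_nhds_unique h2 (tendsto_const_nhds.congr' ?_)
    filter_upwards [(hi w).eventually (isOpen_ne.mem_nhds hMw),
      hx.eventually (isOpen_ne.mem_nhds hv)] with j hj hj0
    refine ((HProj.toMat_ofVec_eq_zero_iff (hB0 j _ hj0) i).mpr ?_).symm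
    rw [Matrix.mulVec_add, Matrix.mulVec_smul, Pi.add_apply, Pi.smul_apply,
      MulOpposite.smul_eq_mul_unop, MulOpposite.unop_op, mul_neg, ← mul_assoc,
      mul_inv_cancel₀ hj, one_mul, add_neg_cancel]
  rw [hp1] at h3
  exact hMw ((HProj.toMat_ofVec_eq_zero_iff hMw0 i).mp h3)

end

/-! ### Quaternionic matrices as complex endomorphisms -/

theorem quaternion_norm_coe_complex (z : ℂ) : ‖(z : ℍ[ℝ])‖ = ‖z‖ := by
  rw [← sq_eq_sq₀ (norm_nonneg _) (norm_nonneg _), Complex.sq_norm, Complex.normSq_apply, sq,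
    ← Quaternion.normSq_eq_norm_mul_self, Quaternion.normSq_def']
  simp [sq]

/-- The complex structure on the quaternions given by right multiplication. -/
noncomputable instance quaternionRightNormedSpace : NormedSpace ℂ ℍ[ℝ] where
  smul z q := q * (z : ℍ[ℝ])
  one_smul q := by change q * _ = q; simp
  mul_smul y z q := by
    change q * _ = q * _ * _
    rw [mul_comm y z, Quaternion.coeComplex_mul, mul_assoc]
  smul_zero z := by change 0 * _ = _; simp
  smul_add z p q := by change (p + q) * _ = p * _ + q * _; rw [add_mul]
  add_smul y z q := by change q * _ = q * _ + q * _; rw [Quaternion.coeComplex_add, mul_add]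
  zero_smul q := by change q * _ = _; simp
  norm_smul_le z q := by
    change ‖q * (z : ℍ[ℝ])‖ ≤ _
    rw [norm_mul, quaternion_norm_coe_complex, mul_comm]

theorem complex_smul_quaternion (z : ℂ) (q : ℍ[ℝ]) : z • q = q * (z : ℍ[ℝ]) := rfl

instance quaternionRightIsScalarTower : IsScalarTower ℝ ℂ ℍ[ℝ] where
  smul_assoc r z q := by
    simp only [complex_smul_quaternion]
    ext <;> simp <;> ring

instance quaternionRightFiniteDimensional : FiniteDimensional ℂ ℍ[ℝ] :=
  Module.Finite.of_restrictScalars_finite ℝ ℂ ℍ[ℝ]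

section

variable {n : ℕ}

theorem complex_smul_eq_op_smul (z : ℂ) (v : VecH n) :
    z • v = MulOpposite.op (z : ℍ[ℝ]) • v := rfl

theorem ofReal_smul_vecH (r : ℝ) (v : VecH n) : (r : ℂ) • v = r • v :=
  algebraMap_smul ℂ r v

/-- A quaternionic matrix as a complex endomorphism of `ℍ^{n+1}`. -/
noncomputable def matHToEndC (n : ℕ) : MatH n →* Module.End ℂ (VecH n) where
  toFun A :=
    { toFun := fun v => A *ᵥ v
      map_add' := fun v w => Matrix.mulVec_add A v w
      map_smul' := fun z v => by
        rw [complex_smul_eq_op_smul, Matrix.mulVec_smul]; rfl }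
  map_one' := LinearMap.ext fun v => Matrix.one_mulVec v
  map_mul' A B := LinearMap.ext fun v => (Matrix.mulVec_mulVec v A B).symm

theorem matHToEndC_apply (A : MatH n) (v : VecH n) : matHToEndC n A v = A *ᵥ v := rfl

theorem matHToEndC_pow_apply (A : MatH n) (m : ℕ) (v : VecH n) :
    (matHToEndC n A ^ m) v = (A ^ m) *ᵥ v := by rw [← map_pow]; rfl

theorem matHToEndC_mul_inv (A : (MatH n)ˣ) :
    matHToEndC n A * matHToEndC n ((A⁻¹ : (MatH n)ˣ) : MatH n) = 1 := by
  rw [← map_mul, Units.mul_inv, map_one]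

theorem matHToEndC_inv_mul (A : (MatH n)ˣ) :
    matHToEndC n ((A⁻¹ : (MatH n)ˣ) : MatH n) * matHToEndC n A = 1 := by
  rw [← map_mul, Units.inv_mul, map_one]

/-! ### The determinant -/

/-- The complex coordinates `a`, `-conj b` of the entries `a + b j` of a quaternionic vector. -/
noncomputable def complexCoords (n : ℕ) : VecH n →ₗ[ℂ] (Fin (n + 1) ⊕ Fin (n + 1) → ℂ) where
  toFun v := Sum.elim (fun i => quatFst (v i)) (fun i => -star (quatSnd (v i)))
  map_add' v w := by
    ext (i | i) <;> apply Complex.ext <;> simp [quatFst, quatSnd, add_comm]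
  map_smul' z v := by
    ext (i | i) <;> apply Complex.ext <;>
      simp [quatFst, quatSnd, complex_smul_quaternion] <;> ring

theorem complexCoords_injective (n : ℕ) : Function.Injective (complexCoords n) := by
  intro v w h
  funext i
  have h1 := congrFun h (Sum.inl i)
  have h2 := congrFun h (Sum.inr i)
  simp only [complexCoords, LinearMap.coe_mk, AddHom.coe_mk, Sum.elim_inl, Sum.elim_inr,
    neg_inj, star_inj] at h1 h2
  have a := congrArg Complex.re h1
  have b := congrArg Complex.im h1
  have c := congrArg Complex.re h2
  have d := congrArg Complex.im h2
  exact QuaternionAlgebra.ext a b c d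

theorem complexCoords_surjective (n : ℕ) : Function.Surjective (complexCoords n) := by
  intro x
  refine ⟨fun i => ⟨(x (Sum.inl i)).re, (x (Sum.inl i)).im, -(x (Sum.inr i)).re,
    (x (Sum.inr i)).im⟩, ?_⟩
  ext (i | i) <;> apply Complex.ext <;> simp [complexCoords, quatFst, quatSnd]

/-- Since `(a + b j) z = a z + b conj(z) j`, the second coordinate must be conjugated to be linear;
its sign matches the lower blocks of `complexEmbed A`. -/
theorem complexCoords_mulVec (A : MatH n) (v : VecH n) :
    complexCoords n (A *ᵥ v) = complexEmbed A *ᵥ complexCoords n v := by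
  ext (i | i)
  · simp [complexCoords, complexEmbed, Matrix.mulVec, dotProduct, quatFst_sum, quatFst_mul,
      Finset.sum_add_distrib, Finset.sum_neg_distrib, sub_eq_add_neg]
  · simp [complexCoords, complexEmbed, Matrix.mulVec, dotProduct, quatSnd_sum, quatSnd_mul,
      Finset.sum_add_distrib]

theorem matHToEndC_hasEigenvalue_of_isRoot {A : MatH n} {μ : ℂ}
    (h : (complexEmbed A).charpoly.IsRoot μ) : (matHToEndC n A).HasEigenvalue μ := by
  rw [← Matrix.charpoly_toLin', ← Module.End.hasEigenvalue_iff_isRoot_charpoly] at h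
  obtain ⟨x, hx⟩ := h.exists_hasEigenvector
  obtain ⟨v, rfl⟩ := complexCoords_surjective n x
  refine Module.End.hasEigenvalue_of_hasEigenvector (x := v)
    ⟨Module.End.mem_eigenspace_iff.mpr (complexCoords_injective n ?_), fun hv => hx.2 (by
      rw [hv, map_zero])⟩
  rw [matHToEndC_apply, complexCoords_mulVec, map_smul, ← Matrix.toLin'_apply]
  exact hx.apply_eq_smul

/-- The determinant is the product of the roots of the characteristic polynomial, so a common
modulus `R` satisfies `R ^ (2 * (n + 1)) = 1`. -/
theorem eq_one_of_forall_norm_eigenvalue_eq {A : MatH n} (hA : detH A = 1) {R : ℝ} (hR : 0 ≤ R)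
    (h : ∀ μ, (matHToEndC n A).HasEigenvalue μ → ‖μ‖ = R) : R = 1 := by
  rw [detH, Matrix.det_eq_prod_roots_charpoly] at hA
  have h1 : ((complexEmbed A).charpoly.roots.map fun μ => ‖μ‖).prod = 1 := by
    have := congrArg norm hA
    rw [norm_one] at this
    rw [← this]
    exact Multiset.prod_hom _ (normHom (α := ℂ))
  have h2 : ((complexEmbed A).charpoly.roots.map fun μ => ‖μ‖) =
      Multiset.replicate (Multiset.card (complexEmbed A).charpoly.roots) R := by
    rw [Multiset.eq_replicate]
    refine ⟨Multiset.card_map _ _, fun x hx => ?_⟩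
    obtain ⟨μ, hμ, rfl⟩ := Multiset.mem_map.mp hx
    exact h μ (matHToEndC_hasEigenvalue_of_isRoot (Polynomial.isRoot_of_mem_roots hμ))
  rw [h2, Multiset.prod_replicate] at h1
  refine (pow_eq_one_iff_of_nonneg hR ?_).mp h1
  rw [← (IsAlgClosed.splits (complexEmbed A).charpoly).natDegree_eq_card_roots,
    Matrix.charpoly_natDegree_eq_dim]
  exact Fintype.card_ne_zero

/-! ### Eigenvalues and diagonalizability -/

theorem isRightEigenvalue_of_hasEigenvalue {A : MatH n} {μ : ℂ}
    (h : (matHToEndC n A).HasEigenvalue μ) : IsRightEigenvalue A (μ : ℍ[ℝ]) := by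
  obtain ⟨v, hv⟩ := h.exists_hasEigenvector
  exact ⟨v, hv.2, hv.apply_eq_smul⟩

/-- A quaternion `q` satisfies a real quadratic equation with complex roots `μ` and `conj μ` of
modulus `‖q‖`. Hence `(T - μ) (T - conj μ) v = 0`, and either `v` or `(T - conj μ) v` is an
eigenvector. -/
theorem exists_hasEigenvalue_of_isRightEigenvalue {A : MatH n} {q : ℍ[ℝ]}
    (h : IsRightEigenvalue A q) : ∃ μ, (matHToEndC n A).HasEigenvalue μ ∧ ‖μ‖ = ‖q‖ := by
  obtain ⟨v, hv, hAv⟩ := h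
  have hAv : A *ᵥ v = MulOpposite.op q • v := hAv
  have hnorm : ‖q‖ ^ 2 = q.re ^ 2 + q.imI ^ 2 + q.imJ ^ 2 + q.imK ^ 2 := by
    rw [sq, ← Quaternion.normSq_eq_norm_mul_self, Quaternion.normSq_def']
  let s : ℝ := Real.sqrt (q.imI ^ 2 + q.imJ ^ 2 + q.imK ^ 2)
  have hs : s ^ 2 = q.imI ^ 2 + q.imJ ^ 2 + q.imK ^ 2 := Real.sq_sqrt (by positivity)
  let μ : ℂ := ⟨q.re, s⟩
  have hμ : ‖μ‖ = ‖q‖ := by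
    rw [← sq_eq_sq₀ (norm_nonneg _) (norm_nonneg _), Complex.sq_norm, Complex.normSq_apply, hnorm]
    simp only [μ]
    rw [← sq, ← sq, hs]; ring
  by_cases hu : A *ᵥ v = (star μ) • v
  · exact ⟨star μ, Module.End.hasEigenvalue_of_hasEigenvector
      ⟨Module.End.mem_eigenspace_iff.mpr hu, hv⟩, by rw [norm_star, hμ]⟩
  · refine ⟨μ, Module.End.hasEigenvalue_of_hasEigenvector (x := A *ᵥ v - (star μ) • v)
      ⟨Module.End.mem_eigenspace_iff.mpr ?_, sub_ne_zero.mpr hu⟩, hμ⟩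
    have hq : q * q - q * (star μ : ℂ) = q * (μ : ℂ) - (star μ : ℂ) * (μ : ℂ) := by
      ext <;> simp [μ] <;> linarith
    rw [map_sub, map_smul, matHToEndC_apply, matHToEndC_apply, hAv, Matrix.mulVec_smul, hAv]
    funext i
    change v i * q * q - v i * q * (star μ : ℂ) = (v i * q - v i * (star μ : ℂ)) * (μ : ℂ)
    rw [sub_mul, mul_assoc, mul_assoc, mul_assoc, mul_assoc, ← mul_sub, hq, mul_sub]

theorem forall_norm_eq_one_iff (A : MatH n) :
    (∀ q, IsRightEigenvalue A q → ‖q‖ = 1) ↔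
      ∀ μ, (matHToEndC n A).HasEigenvalue μ → ‖μ‖ = 1 := by
  refine ⟨fun h μ hμ => ?_, fun h q hq => ?_⟩
  · rw [← quaternion_norm_coe_complex]
    exact h _ (isRightEigenvalue_of_hasEigenvalue hμ)
  · obtain ⟨μ, hμ, he⟩ := exists_hasEigenvalue_of_isRightEigenvalue hq
    rw [← he, h μ hμ]

theorem finrank_quaternion_op : Module.finrank ℍ[ℝ]ᵐᵒᵖ ℍ[ℝ] = 1 :=
  finrank_eq_one 1 one_ne_zero fun w => ⟨MulOpposite.op w, by simp⟩

instance finite_quaternion_op : Module.Finite ℍ[ℝ]ᵐᵒᵖ ℍ[ℝ] :=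
  Module.finite_of_finrank_pos (by rw [finrank_quaternion_op]; exact one_pos)

theorem finrank_vecH (n : ℕ) : Module.finrank ℍ[ℝ]ᵐᵒᵖ (VecH n) = n + 1 := by
  rw [Module.finrank_pi_fintype]
  simp [finrank_quaternion_op]

/-- Complex eigenvectors that span over `ℂ` also span over `ℍ`. A quaternionic basis chosen among
vectors with `A v = v q` gives the columns of the conjugating matrix. -/
theorem isDiagonalizableH_of_iSup_eigenspace_eq_top {A : MatH n}
    (h : ⨆ μ, (matHToEndC n A).eigenspace μ = ⊤) : IsDiagonalizableH A := by
  let s : Set (VecH n) := {v | ∃ q : ℍ[ℝ], A *ᵥ v = MulOpposite.op q • v}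
  have hs : ⊤ ≤ Submodule.span ℍ[ℝ]ᵐᵒᵖ s := by
    intro v _
    have hv : v ∈ ⨆ μ, (matHToEndC n A).eigenspace μ := h ▸ Submodule.mem_top
    refine Submodule.iSup_induction (motive := fun v => v ∈ Submodule.span ℍ[ℝ]ᵐᵒᵖ s) _ hv
      (fun μ w hw => Submodule.subset_span ⟨μ, ?_⟩) (zero_mem _) fun _ _ => add_mem
    exact Module.End.mem_eigenspace_iff.mp hw
  let b₀ := Module.Basis.ofSpan hs
  have hfin := Module.Finite.finite_basis b₀
  have := Fintype.ofFinite ((linearIndepOn_empty ℍ[ℝ]ᵐᵒᵖ id).extend (Set.empty_subset s))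
  let e := Fintype.equivFinOfCardEq ((Module.finrank_eq_card_basis b₀).symm.trans (finrank_vecH n))
  let b := b₀.reindex e
  have hb : ∀ l, ∃ q : ℍ[ℝ], A *ᵥ b l = MulOpposite.op q • b l := by
    intro l
    rw [Module.Basis.reindex_apply]
    exact Module.Basis.ofSpan_subset hs ⟨_, rfl⟩
  choose d hd using hb
  let P : MatH n := Matrix.of fun i l => b l i
  let Q : MatH n := Matrix.of fun l i => (b.repr (Pi.single i 1) l).unop
  have hPQ : P * Q = 1 := by
    ext1 j i
    have h1 := congrFun (b.sum_repr (Pi.single i 1)) j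
    rw [Finset.sum_apply] at h1
    rw [Matrix.mul_apply, Matrix.one_apply]
    rw [Pi.single_apply] at h1
    exact h1
  -- Square matrices over a division ring with a one-sided inverse are invertible.
  have hQP : Q * P = 1 := mul_eq_one_comm.mp hPQ
  have hAP : A * P = P * Matrix.diagonal d := by
    ext1 i l
    rw [Matrix.mul_diagonal]
    exact congrFun (hd l) i
  refine ⟨⟨Q, P, hQP, hPQ⟩, d, ?_⟩
  change Q * A * P = _
  rw [mul_assoc, hAP, ← mul_assoc, hQP, one_mul]

theorem isRightEigenvalue_of_diagonalization {A : MatH n} {S : (MatH n)ˣ} {d : Fin (n + 1) → ℍ[ℝ]}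
    (h : (S : MatH n) * A * ((S⁻¹ : (MatH n)ˣ) : MatH n) = Matrix.diagonal d) (i : Fin (n + 1)) :
    IsRightEigenvalue A (d i) := by
  have h' : A * ((S⁻¹ : (MatH n)ˣ) : MatH n) = ((S⁻¹ : (MatH n)ˣ) : MatH n) * Matrix.diagonal d := by
    rw [← h, ← mul_assoc, ← mul_assoc, Units.inv_mul, one_mul]
  refine ⟨((S⁻¹ : (MatH n)ˣ) : MatH n) *ᵥ Pi.single i 1, mulVec_units_ne_zero _ ?_, ?_⟩
  · intro h0
    simpa using congrFun h0 i
  · rw [Matrix.mulVec_mulVec, h', Matrix.mulVec_single_one, Matrix.mulVec_single_one]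
    funext j
    simp [Matrix.mul_diagonal]

theorem exists_norm_pow_mulVec_le {A : MatH n} {S : (MatH n)ˣ} {d : Fin (n + 1) → ℍ[ℝ]}
    (h : (S : MatH n) * A * ((S⁻¹ : (MatH n)ˣ) : MatH n) = Matrix.diagonal d)
    (hd : ∀ i, ‖d i‖ = 1) : ∃ C : ℝ, ∀ (m : ℕ) (v : VecH n), ‖(A ^ m) *ᵥ v‖ ≤ C * ‖v‖ := by
  have hbd : ∀ B : MatH n, ∃ C : ℝ, 0 ≤ C ∧ ∀ v : VecH n, ‖B *ᵥ v‖ ≤ C * ‖v‖ := fun B =>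
    ⟨‖(LinearMap.toContinuousLinearMap (matHToEndC n B))‖, norm_nonneg _, fun v =>
      (LinearMap.toContinuousLinearMap (matHToEndC n B)).le_opNorm v⟩
  obtain ⟨C, hC0, hC⟩ := hbd S
  obtain ⟨C', hC0', hC'⟩ := hbd ((S⁻¹ : (MatH n)ˣ) : MatH n)
  have hA : A = ((S⁻¹ : (MatH n)ˣ) : MatH n) * Matrix.diagonal d * S := by
    rw [← h, mul_assoc, mul_assoc, Units.inv_mul, mul_one, ← mul_assoc, Units.inv_mul, one_mul]
  have hpow : ∀ m, A ^ m = ((S⁻¹ : (MatH n)ˣ) : MatH n) * Matrix.diagonal d ^ m * S := by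
    intro m
    rw [hA]
    exact Units.conj_pow' S (Matrix.diagonal d) m
  refine ⟨C' * C, fun m v => ?_⟩
  have hD : ∀ w : VecH n, ‖Matrix.diagonal d ^ m *ᵥ w‖ ≤ ‖w‖ := by
    intro w
    rw [pi_norm_le_iff_of_nonneg (norm_nonneg _)]
    intro i
    rw [Matrix.diagonal_pow, Matrix.mulVec_diagonal, norm_mul, Pi.pow_apply, norm_pow, hd, one_pow,
      one_mul]
    exact norm_le_pi_norm w i
  rw [hpow, ← Matrix.mulVec_mulVec, ← Matrix.mulVec_mulVec]
  calc _ ≤ C' * ‖Matrix.diagonal d ^ m *ᵥ ((S : MatH n) *ᵥ v)‖ := hC' _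
    _ ≤ C' * (C * ‖v‖) := by gcongr; exact (hD _).trans (hC v)
    _ = _ := by ring

theorem diagonalization_inv {A S : (MatH n)ˣ} {d : Fin (n + 1) → ℍ[ℝ]}
    (h : (S : MatH n) * A * ((S⁻¹ : (MatH n)ˣ) : MatH n) = Matrix.diagonal d) (hd : ∀ i, d i ≠ 0) :
    (S : MatH n) * ((A⁻¹ : (MatH n)ˣ) : MatH n) * ((S⁻¹ : (MatH n)ˣ) : MatH n) =
      Matrix.diagonal fun i => (d i)⁻¹ := by
  have h1 : ((S * A * S⁻¹ : (MatH n)ˣ) : MatH n) = Matrix.diagonal d := h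
  have h2 : (S * A * S⁻¹)⁻¹ = S * A⁻¹ * S⁻¹ := by group
  change ((S * A⁻¹ * S⁻¹ : (MatH n)ˣ) : MatH n) = _
  rw [← h2]
  refine Units.inv_eq_of_mul_eq_one_right ?_
  rw [h1, Matrix.diagonal_mul_diagonal, ← Matrix.diagonal_one]
  congr 1
  funext i
  exact mul_inv_cancel₀ (hd i)

/-! ### Lifts -/

theorem IsLift.exists_scalar {A A' : ↥(SLH n)} {γ : PSLH n} (h : IsLift A γ) (h' : IsLift A' γ) :
    ∃ q : ℍ[ℝ], (∀ x, q * x = x * q) ∧ ((A' : (MatH n)ˣ) : MatH n) =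
      ((A : (MatH n)ˣ) : MatH n) * Matrix.scalar (Fin (n + 1)) q := by
  have h1 : A⁻¹ * A' ∈ Subgroup.center ↥(SLH n) := QuotientGroup.eq.mp (h.trans h'.symm)
  obtain ⟨q, hq, hc⟩ := SLH.center_scalar h1
  refine ⟨q, hc, ?_⟩
  rw [hq]
  change _ = (((A * (A⁻¹ * A') : ↥(SLH n)) : (MatH n)ˣ) : MatH n)
  rw [mul_inv_cancel_left]

theorem IsDiagonalizableH.mul_scalar {A : MatH n} (h : IsDiagonalizableH A) {q : ℍ[ℝ]}
    (hq : ∀ x, q * x = x * q) : IsDiagonalizableH (A * Matrix.scalar (Fin (n + 1)) q) := by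
  obtain ⟨S, d, hd⟩ := h
  refine ⟨S, fun i => d i * q, ?_⟩
  have hc : Matrix.scalar (Fin (n + 1)) q * ((S⁻¹ : (MatH n)ˣ) : MatH n) =
      ((S⁻¹ : (MatH n)ˣ) : MatH n) * Matrix.scalar (Fin (n + 1)) q :=
    Matrix.scalar_commute q hq _
  rw [mul_assoc, mul_assoc, hc, ← mul_assoc, ← mul_assoc, hd, Matrix.scalar_apply,
    Matrix.diagonal_mul_diagonal]

theorem IsLift.isDiagonalizable_iff {A : ↥(SLH n)} {γ : PSLH n} (h : IsLift A γ) :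
    γ.IsDiagonalizable ↔ IsDiagonalizableH ((A : (MatH n)ˣ) : MatH n) := by
  refine ⟨fun ⟨B, hB, hd⟩ => ?_, fun hd => ⟨A, h, hd⟩⟩
  obtain ⟨q, hq, he⟩ := hB.exists_scalar h
  rw [he]
  exact hd.mul_scalar hq

/-- Two lifts differ by a central scalar `q`. If one lift has unimodular eigenvalues, all those of
the other have modulus `‖q‖⁻¹`, and the determinant condition forces this to be `1`. -/
theorem IsLift.hasUnitEigenvalues_iff {A : ↥(SLH n)} {γ : PSLH n} (h : IsLift A γ) :
    γ.HasUnitEigenvalues ↔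
      ∀ μ, (matHToEndC n ((A : (MatH n)ˣ) : MatH n)).HasEigenvalue μ → ‖μ‖ = 1 := by
  rw [← forall_norm_eq_one_iff]
  refine ⟨fun ⟨B, hB, hd⟩ => ?_, fun hd => ⟨A, h, hd⟩⟩
  obtain ⟨q, hq, he⟩ := h.exists_scalar hB
  have hmul : ∀ p, IsRightEigenvalue ((A : (MatH n)ˣ) : MatH n) p → ‖p‖ * ‖q‖ = 1 := by
    rintro p ⟨v, hv, hp⟩
    rw [← norm_mul]
    refine hd _ ⟨v, hv, ?_⟩
    have hs : Matrix.scalar (Fin (n + 1)) q *ᵥ v = MulOpposite.op q • v := by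
      funext i
      simp [Matrix.scalar_apply, Matrix.mulVec_diagonal, hq]
    rw [he, ← Matrix.mulVec_mulVec, hs, Matrix.mulVec_smul, hp]
    funext i
    simp [mul_assoc]
  have h1 : ‖q‖⁻¹ = 1 := eq_one_of_forall_norm_eigenvalue_eq A.2 (inv_nonneg.mpr (norm_nonneg q))
    fun μ hμ => by
      have := hmul _ (isRightEigenvalue_of_hasEigenvalue hμ)
      rw [quaternion_norm_coe_complex] at this
      exact eq_inv_of_mul_eq_one_left this
  intro p hp
  rw [eq_inv_of_mul_eq_one_left (hmul p hp), h1]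

end

/-! ### The region of equicontinuity of a cyclic group -/

section

variable {n : ℕ}

theorem tendsto_matH {α : Type*} {l : Filter α} {B : α → MatH n} {M : MatH n}
    (h : ∀ i k, Filter.Tendsto (fun a => B a i k) l (𝓝 (M i k))) : Filter.Tendsto B l (𝓝 M) :=
  tendsto_pi_nhds.mpr fun i => tendsto_pi_nhds.mpr fun k => h i k

theorem exists_subseq_tendsto_of_mulVec_bounded (B : ℕ → MatH n)
    (h : ∀ v : VecH n, ∃ C : ℝ, ∀ j, ‖B j *ᵥ v‖ ≤ C) :
    ∃ ψ : ℕ → ℕ, StrictMono ψ ∧ ∃ M : MatH n, Filter.Tendsto (B ∘ ψ) Filter.atTop (𝓝 M) := by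
  have : ProperSpace ℍ[ℝ] := FiniteDimensional.proper_real ℍ[ℝ]
  choose C hC using fun l : Fin (n + 1) => h (Pi.single l 1)
  let x : ℕ → Fin (n + 1) → VecH n := fun j l => B j *ᵥ Pi.single l 1
  have hx : ∀ j, x j ∈ Set.pi Set.univ fun l => Metric.closedBall (0 : VecH n) (C l) := fun j l _ =>
    mem_closedBall_zero_iff.mpr (hC l j)
  obtain ⟨a, -, ψ, hψ, hlim⟩ := tendsto_subseq_of_bounded
    (Bornology.IsBounded.pi fun l => Metric.isBounded_closedBall) hx
  refine ⟨ψ, hψ, Matrix.of fun i l => a l i, tendsto_matH fun i k => ?_⟩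
  have h1 := ((continuous_apply_apply k i).tendsto a).comp hlim
  refine h1.congr fun j => ?_
  simp [x]

/-- Compactness gives a limit `M` depending on the subsequence. Its kernel does not, by
`HasGrowth.tendsto_zero_of_subseq`, and it is proper because some vector is not slow. -/
theorem HasGrowth.exists_subseq_tendsto_matH {A A' : MatH n} (h' : A' * A = 1)
    {R : ℝ} {k : ℕ} (h : HasGrowth (matHToEndC n A) R k) {p : ℕ → ℕ}
    (hp : Filter.Tendsto p Filter.atTop Filter.atTop) :
    ∃ ψ : ℕ → ℕ, StrictMono ψ ∧ ∃ M : MatH n, M ≠ 0 ∧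
      (∀ v, M *ᵥ v = 0 ↔ v ∈ growthSmall (matHToEndC n A) R k) ∧
      Filter.Tendsto (fun j => growthScale R k (p (ψ j)) • A ^ p (ψ j)) Filter.atTop (𝓝 M) := by
  have h0 : ¬ (matHToEndC n A).HasEigenvalue 0 :=
    not_hasEigenvalue_zero_of_mul_eq_one (by rw [← map_mul, h', map_one])
  have he : ∀ m (v : VecH n), (growthScale R k m • A ^ m) *ᵥ v =
      (growthScale R k m : ℂ) • (matHToEndC n A ^ m) v := fun m v => by
    rw [ofReal_smul_vecH, matHToEndC_pow_apply, Matrix.smul_mulVec]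
  obtain ⟨ψ, hψ, M, hM⟩ := exists_subseq_tendsto_of_mulVec_bounded
    (fun j => growthScale R k (p j) • A ^ p j) (fun v => by
      obtain ⟨C, hC⟩ := h.exists_norm_le h0 v
      exact ⟨C, fun j => by rw [he]; exact hC _⟩)
  have hlim : ∀ v : VecH n, Filter.Tendsto (fun j => (growthScale R k (p (ψ j)) : ℂ) •
      (matHToEndC n A ^ p (ψ j)) v) Filter.atTop (𝓝 (M *ᵥ v)) := fun v =>
    (tendsto_mulVec hM tendsto_const_nhds).congr fun j => he _ v
  have hpψ := hp.comp hψ.tendsto_atTop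
  have hker : ∀ v, M *ᵥ v = 0 ↔ v ∈ growthSmall (matHToEndC n A) R k := by
    refine fun v => ⟨fun hv => ?_, fun hv => ?_⟩
    · have h1 := hlim v
      rw [hv] at h1
      exact h.tendsto_zero_of_subseq h0 hpψ h1
    · exact tendsto_nhds_unique (hlim v) ((mem_growthSmall.mp hv).comp hpψ)
  refine ⟨ψ, hψ, M, fun hM0 => h.growthSmall_ne_top ?_, hker, hM⟩
  rw [Submodule.eq_top_iff']
  exact fun v => (hker v).mp (by rw [hM0, Matrix.zero_mulVec])

/-- The scale is real and `A` acts right-linearly, so the complex subspace of slow vectors is stable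
under all of `ℍ`. -/
theorem smul_mem_growthSmall {A : MatH n} {R : ℝ} {k : ℕ} (t : ℍ[ℝ]ᵐᵒᵖ) {v : VecH n}
    (hv : v ∈ growthSmall (matHToEndC n A) R k) : t • v ∈ growthSmall (matHToEndC n A) R k := by
  have h := Filter.Tendsto.const_smul (mem_growthSmall.mp hv) t
  rw [smul_zero] at h
  refine h.congr fun m => ?_
  rw [ofReal_smul_vecH, ofReal_smul_vecH, matHToEndC_pow_apply, matHToEndC_pow_apply,
    Matrix.mulVec_smul, smul_comm]

/-- The slowly growing vectors of `ℍ^{n+1}` as a quaternionic subspace. -/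
noncomputable def growthSmallH (A : MatH n) (R : ℝ) (k : ℕ) : Submodule ℍ[ℝ]ᵐᵒᵖ (VecH n) where
  carrier := growthSmall (matHToEndC n A) R k
  zero_mem' := zero_mem _
  add_mem' := add_mem
  smul_mem' t _ hv := smul_mem_growthSmall t hv

theorem mem_growthSmallH {A : MatH n} {R : ℝ} {k : ℕ} {v : VecH n} :
    v ∈ growthSmallH A R k ↔ v ∈ growthSmall (matHToEndC n A) R k := Iff.rfl

theorem growthSmallH_eq_bot_iff {A : MatH n} {R : ℝ} {k : ℕ} :
    growthSmallH A R k = ⊥ ↔ growthSmall (matHToEndC n A) R k = ⊥ := by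
  rw [Submodule.eq_bot_iff, Submodule.eq_bot_iff]
  rfl

/-- The points of `ℙ^n_ℍ` on a quaternionic subspace. -/
def projSet (W : Submodule ℍ[ℝ]ᵐᵒᵖ (VecH n)) : Set (HProj n) :=
  {p | ∃ (v : VecH n) (hv : v ≠ 0), v ∈ W ∧ p = Projectivization.mk ℍ[ℝ]ᵐᵒᵖ v hv}

theorem ofVec_mem_projSet {W : Submodule ℍ[ℝ]ᵐᵒᵖ (VecH n)} {v : VecH n} (hv : v ≠ 0) :
    HProj.ofVec v ∈ projSet W ↔ v ∈ W := by
  refine ⟨?_, fun h => ⟨v, hv, h, HProj.ofVec_of_ne hv⟩⟩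
  rintro ⟨w, hw, hwW, h⟩
  rw [← HProj.ofVec_of_ne hw] at h
  obtain ⟨t, rfl⟩ := (HProj.ofVec_eq_ofVec_iff hv hw).mp h
  exact W.smul_mem t hwW

theorem projSet_subset_iff {W W' : Submodule ℍ[ℝ]ᵐᵒᵖ (VecH n)} : projSet W ⊆ projSet W' ↔ W ≤ W' := by
  refine ⟨fun h v hv => ?_, fun h p ⟨v, hv, hvW, hp⟩ => ⟨v, hv, h hvW, hp⟩⟩
  by_cases hv0 : v = 0
  · rw [hv0]; exact zero_mem _
  · exact (ofVec_mem_projSet hv0).mp (h ((ofVec_mem_projSet hv0).mpr hv))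

theorem projSet_bot : projSet (⊥ : Submodule ℍ[ℝ]ᵐᵒᵖ (VecH n)) = ∅ := by
  rw [Set.eq_empty_iff_forall_notMem]
  rintro p ⟨v, hv, h, -⟩
  exact hv h

theorem projSet_top : projSet (⊤ : Submodule ℍ[ℝ]ᵐᵒᵖ (VecH n)) = Set.univ := by
  rw [Set.eq_univ_iff_forall]
  intro p
  obtain ⟨v, hv, rfl⟩ := HProj.exists_ofVec_eq p
  exact (ofVec_mem_projSet hv).mpr trivial

theorem projSet_injective : Function.Injective
    (projSet : Submodule ℍ[ℝ]ᵐᵒᵖ (VecH n) → Set (HProj n)) := fun _ _ h =>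
  le_antisymm (projSet_subset_iff.mp h.le) (projSet_subset_iff.mp h.ge)

theorem isClosed_projSet (W : Submodule ℍ[ℝ]ᵐᵒᵖ (VecH n)) : IsClosed (projSet W) := by
  have hW : IsClosed (W : Set (VecH n)) := by
    let W' : Submodule ℝ (VecH n) :=
      { carrier := W
        zero_mem' := zero_mem W
        add_mem' := add_mem
        smul_mem' := fun c v hv => by
          rw [HProj.real_smul_eq]; exact W.smul_mem _ hv }
    exact W'.closed_of_finiteDimensional
  rw [← isOpen_compl_iff, isOpen_iff_mem_nhds]
  intro p hp
  obtain ⟨v, hv, rfl⟩ := HProj.exists_ofVec_eq p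
  rw [← HProj.map_ofVec_nhds hv, Filter.mem_map]
  have hvW : v ∉ W := fun h => hp ((ofVec_mem_projSet hv).mpr h)
  filter_upwards [hW.isOpen_compl.mem_nhds hvW, isOpen_ne.mem_nhds hv] with w hw hw0
  exact fun h => hw ((ofVec_mem_projSet hw0).mp h)

/-- A sequence of integers has a subsequence that is constant or tends to `∞` or to `-∞`. -/
theorem exists_subseq_int (m : ℕ → ℤ) : ∃ φ : ℕ → ℕ, StrictMono φ ∧
    ((∃ a, ∀ j, m (φ j) = a) ∨ ∃ p : ℕ → ℕ, Filter.Tendsto p Filter.atTop Filter.atTop ∧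
      ((∀ j, m (φ j) = p j) ∨ ∀ j, m (φ j) = -(p j : ℤ))) := by
  by_cases h1 : ∀ N : ℕ, ∃ᶠ j in Filter.atTop, (N : ℤ) ≤ m j
  · obtain ⟨φ, hφ, h⟩ := Filter.extraction_forall_of_frequently h1
    refine ⟨φ, hφ, Or.inr ⟨fun j => (m (φ j)).toNat, ?_, Or.inl fun j => ?_⟩⟩
    · refine Filter.tendsto_atTop_mono (fun j => ?_) Filter.tendsto_id
      have := h j
      simp only [id]
      omega
    · have := h j
      dsimp only
      omega
  by_cases h2 : ∀ N : ℕ, ∃ᶠ j in Filter.atTop, m j ≤ -(N : ℤ)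
  · obtain ⟨φ, hφ, h⟩ := Filter.extraction_forall_of_frequently h2
    refine ⟨φ, hφ, Or.inr ⟨fun j => (-m (φ j)).toNat, ?_, Or.inr fun j => ?_⟩⟩
    · refine Filter.tendsto_atTop_mono (fun j => ?_) Filter.tendsto_id
      have := h j
      simp only [id]
      omega
    · have := h j
      dsimp only
      omega
  push Not at h1 h2
  obtain ⟨N, hN⟩ := h1
  obtain ⟨N', hN'⟩ := h2
  -- The sequence is now eventually bounded, so some value recurs infinitely often.
  have h3 : ∃ a ∈ Finset.Icc (-(N' : ℤ)) N, ∃ᶠ j in Filter.atTop, m j = a := by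
    by_contra! hcon
    have hcon' : ∀ a ∈ Finset.Icc (-(N' : ℤ)) N, ∀ᶠ j in Filter.atTop, m j ≠ a := fun a ha =>
      hcon a ha
    rw [← Filter.eventually_all_finset] at hcon'
    obtain ⟨j, ⟨hj1, hj2⟩, hj3⟩ := ((hN.and hN').and hcon').exists
    exact hj3 (m j) (Finset.mem_Icc.mpr ⟨by omega, by omega⟩) rfl
  obtain ⟨a, -, ha⟩ := h3
  obtain ⟨φ, hφ, h⟩ := Filter.extraction_of_frequently_atTop ha
  exact ⟨φ, hφ, Or.inl ⟨a, h⟩⟩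

/-- Exponents tending to `∞` are governed by `A`, those tending to `-∞` by its inverse, and a
constant subsequence has an invertible limit that imposes no condition. -/
theorem compl_eqRegion_zpowers (A : ↥(SLH n)) {R R' : ℝ} {k k' : ℕ}
    (h : HasGrowth (matHToEndC n ((A : (MatH n)ˣ) : MatH n)) R k)
    (h' : HasGrowth (matHToEndC n (((A : (MatH n)ˣ)⁻¹ : (MatH n)ˣ) : MatH n)) R' k') :
    (eqRegion (Subgroup.zpowers (QuotientGroup.mk A : PSLH n)))ᶜ =
      projSet (growthSmallH ((A : (MatH n)ˣ) : MatH n) R k) ∪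
      projSet (growthSmallH (((A : (MatH n)ˣ)⁻¹ : (MatH n)ˣ) : MatH n) R' k') := by
  have e1 : ∀ p : ℕ, (((A : (MatH n)ˣ) ^ (p : ℤ) : (MatH n)ˣ) : MatH n) =
      ((A : (MatH n)ˣ) : MatH n) ^ p := fun p => by rw [zpow_natCast, Units.val_pow_eq_pow_val]
  have e2 : ∀ p : ℕ, (((A : (MatH n)ˣ) ^ (-(p : ℤ)) : (MatH n)ˣ) : MatH n) =
      (((A : (MatH n)ˣ)⁻¹ : (MatH n)ˣ) : MatH n) ^ p := fun p => by
    rw [zpow_neg, ← inv_zpow, zpow_natCast, Units.val_pow_eq_pow_val]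
  refine subset_antisymm (Set.compl_subset_comm.mp (subset_eqRegion_zpowers A
    ((isClosed_projSet _).union (isClosed_projSet _)).isOpen_compl fun m => ?_))
    (Set.union_subset ?_ ?_)
  · obtain ⟨φ, hφ, ⟨a, ha⟩ | ⟨p, hp, hm | hm⟩⟩ := exists_subseq_int m
    · refine ⟨φ, hφ, fun _ => 1, fun _ => one_ne_zero, (((A : (MatH n)ˣ) ^ a : (MatH n)ˣ) : MatH n),
        fun v hv _ => mulVec_units_ne_zero _ hv, ?_⟩
      simp only [ha, one_smul]
      exact tendsto_const_nhds
    · obtain ⟨ψ, hψ, M, -, hker, hlim⟩ := h.exists_subseq_tendsto_matH (Units.inv_mul _) hp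
      refine ⟨φ ∘ ψ, hφ.comp hψ, fun j => growthScale R k (p (ψ j)),
        fun j => (growthScale_pos h.pos _ _).ne', M, fun v hv hU hMv => hU (Or.inl ?_), ?_⟩
      · exact (ofVec_mem_projSet hv).mpr ((hker v).mp hMv)
      · simpa only [Function.comp_apply, hm, e1] using hlim
    · obtain ⟨ψ, hψ, M, -, hker, hlim⟩ := h'.exists_subseq_tendsto_matH (Units.mul_inv _) hp
      refine ⟨φ ∘ ψ, hφ.comp hψ, fun j => growthScale R' k' (p (ψ j)),
        fun j => (growthScale_pos h'.pos _ _).ne', M, fun v hv hU hMv => hU (Or.inr ?_), ?_⟩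
      · exact (ofVec_mem_projSet hv).mpr ((hker v).mp hMv)
      · simpa only [Function.comp_apply, hm, e2] using hlim
  · rintro _ ⟨v, hv, hvW, rfl⟩
    obtain ⟨ψ, -, M, hM, hker, hlim⟩ :=
      h.exists_subseq_tendsto_matH (Units.inv_mul _) Filter.tendsto_id
    rw [← HProj.ofVec_of_ne hv]
    refine ofVec_notMem_eqRegion_zpowers (m := fun j => (ψ j : ℤ))
      (c := fun j => growthScale R k (ψ j)) (fun j => (growthScale_pos h.pos _ _).ne') hM ?_ hv
      ((hker v).mpr hvW)
    simpa only [e1, id] using hlim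
  · rintro _ ⟨v, hv, hvW, rfl⟩
    obtain ⟨ψ, -, M, hM, hker, hlim⟩ :=
      h'.exists_subseq_tendsto_matH (Units.mul_inv _) Filter.tendsto_id
    rw [← HProj.ofVec_of_ne hv]
    refine ofVec_notMem_eqRegion_zpowers (m := fun j => -(ψ j : ℤ))
      (c := fun j => growthScale R' k' (ψ j)) (fun j => (growthScale_pos h'.pos _ _).ne') hM ?_ hv
      ((hker v).mpr hvW)
    simpa only [e2, id] using hlim

/-- For `v` in `W₁` only and `w` in `W₂` only, the sum `v + w` lies in neither, so the union is not
closed under addition. -/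
theorem not_isProjSubspace_of_isUnionOfTwoProperSubspaces {Z : Set (HProj n)}
    (h : IsUnionOfTwoProperSubspaces Z) : ¬ IsProjSubspace Z := by
  obtain ⟨_, _, ⟨W₁, h₁, rfl⟩, ⟨W₂, h₂, rfl⟩, -, -, h12, h21, rfl⟩ := h
  rintro ⟨W, hW, he⟩
  change projSet W₁ ∪ projSet W₂ = projSet W at he
  change ¬ projSet W₁ ⊆ projSet W₂ at h12
  change ¬ projSet W₂ ⊆ projSet W₁ at h21
  rw [projSet_subset_iff, SetLike.not_le_iff_exists] at h12 h21
  obtain ⟨v, hv1, hv2⟩ := h12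
  obtain ⟨w, hw2, hw1⟩ := h21
  have hvW : v ∈ W := projSet_subset_iff.mp (Set.subset_union_left.trans he.le) hv1
  have hwW : w ∈ W := projSet_subset_iff.mp (Set.subset_union_right.trans he.le) hw2
  have hne : v + w ≠ 0 := fun h0 => hv2 (by
    rw [eq_neg_of_add_eq_zero_left h0]; exact neg_mem hw2)
  have hmem := he.ge ((ofVec_mem_projSet hne).mpr (add_mem hvW hwW))
  rcases hmem with hmem | hmem
  · exact hw1 ((Submodule.add_mem_iff_right W₁ hv1).mp ((ofVec_mem_projSet hne).mp hmem))
  · exact hv2 ((Submodule.add_mem_iff_left W₂ hw2).mp ((ofVec_mem_projSet hne).mp hmem))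

theorem not_isProjSubspace_empty : ¬ IsProjSubspace (∅ : Set (HProj n)) := by
  rintro ⟨W, hW, he⟩
  rw [← projSet_bot] at he
  exact hW (projSet_injective he).symm

theorem not_isUnionOfTwoProperSubspaces_empty :
    ¬ IsUnionOfTwoProperSubspaces (∅ : Set (HProj n)) := by
  rintro ⟨L₁, L₂, -, -, -, -, h, -, he⟩
  exact h (Set.subset_union_left.trans (he.symm.le.trans (Set.empty_subset _)))

/-- The limit set of a cyclic group, according to the dynamical type of its generator. -/
theorem compl_eqRegion_trichotomy (γ : PSLH n) :
    (γ.IsDiagonalizable → γ.HasUnitEigenvalues → (eqRegion (Subgroup.zpowers γ))ᶜ = ∅) ∧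
    (¬ γ.IsDiagonalizable → γ.HasUnitEigenvalues →
      IsProjSubspace (eqRegion (Subgroup.zpowers γ))ᶜ) ∧
    (¬ γ.HasUnitEigenvalues → IsUnionOfTwoProperSubspaces (eqRegion (Subgroup.zpowers γ))ᶜ) := by
  obtain ⟨A, rfl⟩ := QuotientGroup.mk_surjective γ
  have hlift : IsLift A (QuotientGroup.mk A) := rfl
  rw [hlift.isDiagonalizable_iff, hlift.hasUnitEigenvalues_iff]
  have hT := matHToEndC_mul_inv (A : (MatH n)ˣ)
  have hT' := matHToEndC_inv_mul (A : (MatH n)ˣ)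
  obtain ⟨R, k, h⟩ := exists_hasGrowth (not_hasEigenvalue_zero_of_mul_eq_one hT')
  obtain ⟨R', k', h'⟩ := exists_hasGrowth (not_hasEigenvalue_zero_of_mul_eq_one hT)
  refine ⟨fun hd hu => ?_, fun hd hu => ?_, fun hu => ?_⟩
  · rw [compl_eqRegion_zpowers A h h']
    obtain ⟨S, d, hS⟩ := hd
    have hd1 : ∀ i, ‖d i‖ = 1 := fun i => (forall_norm_eq_one_iff _).mpr hu _
      (isRightEigenvalue_of_diagonalization hS i)
    obtain ⟨C, hC⟩ := exists_norm_pow_mulVec_le hS hd1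
    obtain ⟨C', hC'⟩ := exists_norm_pow_mulVec_le
      (diagonalization_inv hS fun i => norm_ne_zero_iff.mp (by rw [hd1]; exact one_ne_zero))
      (fun i => by rw [norm_inv, hd1, inv_one])
    have b1 : ∀ m (v : VecH n), ‖(matHToEndC n ((A : (MatH n)ˣ) : MatH n) ^ m) v‖ ≤
        max C C' * ‖v‖ := fun m v => by
      rw [matHToEndC_pow_apply]
      exact (hC m v).trans (mul_le_mul_of_nonneg_right (le_max_left _ _) (norm_nonneg v))
    have b2 : ∀ m (v : VecH n), ‖(matHToEndC n (((A : (MatH n)ˣ)⁻¹ : (MatH n)ˣ) : MatH n) ^ m) v‖ ≤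
        max C C' * ‖v‖ := fun m v => by
      rw [matHToEndC_pow_apply]
      exact (hC' m v).trans (mul_le_mul_of_nonneg_right (le_max_right _ _) (norm_nonneg v))
    have s1 : growthSmallH ((A : (MatH n)ˣ) : MatH n) R k = ⊥ :=
      growthSmallH_eq_bot_iff.mpr
        (h.growthSmall_eq_bot_of_bounded hT' hT b1 b2)
    have s2 : growthSmallH (((A : (MatH n)ˣ)⁻¹ : (MatH n)ˣ) : MatH n) R' k' = ⊥ :=
      growthSmallH_eq_bot_iff.mpr
        (h'.growthSmall_eq_bot_of_bounded hT hT' b2 b1)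
    rw [s1, s2, projSet_bot, Set.union_self]
  · obtain ⟨hR, h''⟩ := HasGrowth.inv_of_forall_norm_eq_one hT hT' h hu
    rw [compl_eqRegion_zpowers A h h'']
    have hs := HasGrowth.growthSmall_eq_inv hT hT' h hu
    have hsH : growthSmallH ((A : (MatH n)ˣ) : MatH n) R k =
        growthSmallH (((A : (MatH n)ˣ)⁻¹ : (MatH n)ˣ) : MatH n) R k := by
      ext v
      rw [mem_growthSmallH, mem_growthSmallH, hs]
    rw [← hsH, Set.union_self]
    refine ⟨_, fun hb => ?_, rfl⟩
    have hk : k ≠ 0 := by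
      rintro rfl
      exact hd (isDiagonalizableH_of_iSup_eigenspace_eq_top
        (h.iSup_eigenspace_eq_top (by rwa [hR])))
    exact h.growthSmall_ne_bot hk (growthSmallH_eq_bot_iff.mp hb)
  · rw [compl_eqRegion_zpowers A h h']
    -- Equality would make all eigenvalue moduli equal to `R`, and the determinant condition would
    -- then give `R = 1`.
    have hRR : 1 < R * R' := by
      refine (HasGrowth.one_le_mul hT hT' h h').lt_of_ne fun he => hu ?_
      have hall := fun μ => HasGrowth.norm_eq_of_mul_eq_one hT hT' h h' he.symm (μ := μ)
      rw [eq_one_of_forall_norm_eigenvalue_eq A.2 h.pos.le hall] at hall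
      exact hall
    -- Each of `v` and `w` lies in exactly one of the two subspaces. Together they show that both
    -- are nonzero and proper and that neither contains the other.
    obtain ⟨v, hv, hv'⟩ := HasGrowth.exists_mem_growthSmall_notMem_inv hT hT' h' hRR (k := k)
    obtain ⟨w, hw, hw'⟩ := HasGrowth.exists_mem_growthSmall_notMem_inv hT' hT h
      (by rwa [mul_comm]) (k := k')
    refine ⟨_, _, ⟨_, fun hb => ?_, rfl⟩, ⟨_, fun hb => ?_, rfl⟩, fun ht => ?_, fun ht => ?_,
      fun hle => ?_, fun hle => ?_, rfl⟩
    · have : v = 0 := (Submodule.eq_bot_iff _).mp hb v hv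
      exact hv' (this ▸ zero_mem _)
    · have : w = 0 := (Submodule.eq_bot_iff _).mp hb w hw
      exact hw' (this ▸ zero_mem _)
    · exact hw' (projSet_subset_iff.mp (projSet_top.le.trans ht.ge) (Submodule.mem_top (x := w)))
    · exact hv' (projSet_subset_iff.mp (projSet_top.le.trans ht.ge) (Submodule.mem_top (x := v)))
    · exact hv' (projSet_subset_iff.mp hle hv)
    · exact hw' (projSet_subset_iff.mp hle hw)

end

theorem mainTheorem1 (n : ℕ) (γ : PSLH n) :
    (γ.IsElliptic ↔ eqRegion (Subgroup.zpowers γ) = Set.univ) ∧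
    (γ.IsParabolic ↔ IsProjSubspace (eqRegion (Subgroup.zpowers γ))ᶜ) ∧
    (γ.IsLoxodromic ↔ γ.IsDiagonalizable ∧
      IsUnionOfTwoProperSubspaces (eqRegion (Subgroup.zpowers γ))ᶜ) ∧
    (γ.IsLoxoparabolic ↔ ¬ γ.IsDiagonalizable ∧
      IsUnionOfTwoProperSubspaces (eqRegion (Subgroup.zpowers γ))ᶜ) := by
  obtain ⟨h1, h2, h3⟩ := compl_eqRegion_trichotomy γ
  have n1 := not_isProjSubspace_empty (n := n)
  have n2 := not_isUnionOfTwoProperSubspaces_empty (n := n)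
  have n3 := @not_isProjSubspace_of_isUnionOfTwoProperSubspaces n
    (eqRegion (Subgroup.zpowers γ))ᶜ
  rw [← Set.compl_empty_iff]
  simp only [PSLH.IsElliptic, PSLH.IsParabolic, PSLH.IsLoxodromic, PSLH.IsLoxoparabolic]
  generalize (eqRegion (Subgroup.zpowers γ))ᶜ = Z at *
  have n1' : Z = ∅ → ¬ IsProjSubspace Z := by rintro rfl; exact n1
  have n2' : Z = ∅ → ¬ IsUnionOfTwoProperSubspaces Z := by rintro rfl; exact n2
  -- The hypotheses of the trichotomy exhaust all cases and its conclusions exclude each other, so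
  -- the converse implications are propositional.
  tauto
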